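/- **Definitions.** A *run-length straight-line program* (RLSLP) over an alphabet $\Sigma$ is an acyclic grammar $\mathcal G$ with a finite set $\mathcal V$ of variables (positive integers), exactly one production $X\to a$ ($a\in\Sigma$), $X\to X_\ell X_r$ or $X\to \hat X^{k}$ ($k\ge 1$) for each variable $X$, different right-hand sides for different variables, and a start symbol $S$ in whose derivation tree every variable appears. $\mathrm{val}(X)$ is the string derived by $X$, and $\mathrm{val}^+(u)=\mathrm{val}(u[1])\cdots \mathrm{val}(u[|u|])$. Put $X.\mathrm{left}=\mathrm{val}(X_\ell)$, $X.\mathrm{right}=\mathrm{val}(X_r)$ for $X\to X_\ell X_r$, and $X.\mathrm{left}=\mathrm{val}(\hat X)$, $X.\mathrm{right}=\mathrm{val}(\hat X)^{k-1}$ for $X\to\hat X^k$. For a string $P$ let $\mathit{pOcc}(P,j)$ be the set of *primary occurrences* of $P$ with split point $j$: all pairs $(X,|X.\mathrm{left}|-j+1)$ such that $P=P_1P_2$ with $|P_1|=j$, $1\le j<|P|$, $P_1$ is a suffix of $X.\mathrm{left}$ and $P_2$ is a prefix of $X.\mathrm{right}$; $\mathit{pOcc}(P)=\bigcup_{1\le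 j<|P|}\mathit{pOcc}(P,j)$. $\mathit{Sig}(x)$ is the variable with right-hand side $x$; $\mathit{Sig}(x_1\cdots x_m)=\mathit{Sig}(\mathit{Sig}(x_1\cdots x_{m-1})x_m)$ for blocks of $m\ge 3$ variables; an undefined value is encoded by $0\notin\mathcal V$; $\mathit{Sig}^+$ applies $\mathit{Sig}$ elementwise. $\mathit{Epow}(s)$ is the sequence of the maximal runs $a^k$ of equal symbols of $s$. Let $M$ be a positive integer, $\Delta_L=\log^*M+6$, $\Delta_R=4$, and let $f$ be a locally consistent parsing function on windows of $\log^*M+11$ integers of $[0..M]$: for every sequence $p$ over $[1..M]$ of length $n\ge2$ with $p[i]\ne p[i+1]$ for all $i$, the bits $d[i]=f(\tilde p[i-\Delta_L],\dots,\tilde p[i+\Delta_R])$ ($\tilde p$ is $p$ continued by zeros) satisfy $d[1]=1$, $d[n]=0$, $d[i]+d[i+1]\le 1$ for $1\le i<n$, and $d[i]+d[i+1]+d[i+2]+d[i+3]\ge1$ for $1\le i<n-3$. $\mathit{Eblock}(p)$ cuts $p$ into blocks that start exactly at the positions $i$ with $d[i]=1$. For a string $T$ put $\mathit{Shrink}_0^T=\mathit{Sig}^+(T)$,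 $\mathit{Pow}_t^T=\mathit{Sig}^+(\mathit{Epow}(\mathit{Shrink}_t^T))$, $\mathit{Shrink}_{t+1}^T=\mathit{Sig}^+(\mathit{Eblock}(\mathit{Pow}_t^T))$. $\mathcal G$ is the *signature encoding* of a nonempty string $T$ with $4|T|\le M$ if $\mathcal V\subseteq[1..M-1]$ and, for the least $h$ with $|\mathit{Pow}_h^T|=1$, all these signatures of levels $t\le h$ are defined and $\mathit{Pow}_h^T=S$. The *common sequence* $\mathit{Uniq}(P)$ is defined as follows. $\mathit{XShrink}_0^P=\mathit{Sig}^+(P)$. Let $\hat L_t,\hat R_t$ be the first and the last maximal run of $\mathit{XShrink}_t^P$, and let $\mathit{XPow}_t^P=\mathit{Sig}^+(\mathit{Epow}(\cdot))$ of $\mathit{XShrink}_t^P$ without $\hat L_t$ and $\hat R_t$. With $d$ the bit sequence of $\mathit{XPow}_t^P$, let $L_t$ be the shortest prefix of $\mathit{XPow}_t^P$ of length at least $\Delta_L$ with $d[|L_t|+1]=1$, let $R_t$ be the shortest suffix of length at least $\Delta_R+1$ with $d[|d|-|R_t|+1]=1$, and let $\mathit{XShrink}_{t+1}^P$ be $\mathit{Sig}^+$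 of the blocks of $\mathit{XPow}_t^P$ strictly between $L_t$ and $R_t$. Let $h^P$ be the least $h$ with $|\mathit{Epow}(\mathit{XShrink}_h^P)|\le\Delta_L+\Delta_R+9$. Then $$\mathit{Uniq}(P)=\hat L_0L_0\cdots\hat L_{h^P-1}L_{h^P-1}\,\mathit{XShrink}_{h^P}^P\,R_{h^P-1}\hat R_{h^P-1}\cdots R_0\hat R_0 .$$ **Lemma.** There is an absolute constant $C>0$ such that the following holds for all $M$, all $f$ as above, every string $T$ and every signature encoding $\mathcal G$ of $T$. Let $P$ be a string with $|P|>1$, let $u=\mathit{Uniq}(P)$ and $$\mathcal P=\{\,|\mathrm{val}^+(u[1..i])| : 1\le i<|u|,\ u[i]\ne u[i+1]\,\}.$$ 1. If $|\mathit{Pow}_0^P|=1$ (when $P$ occurs in $T$: $P$ is a run of a single character), then $\mathit{pOcc}(P)=\mathit{pOcc}(P,1)$. 2. If $|\mathit{Pow}_0^P|>1$, then $\mathit{pOcc}(P)=\bigcup_{j\in\mathcal P}\mathit{pOcc}(P,j)$. 3. If $P$ is a substring of $T$, then all signatures in $\mathit{Uniq}(P)$ are defined; and whenever they are all defined, $|\mathcal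 P|\le C\,\log_2|P|\,\log^*M$. -/

import Mathlib

namespace SigEnc

/-! ### Run-length straight-line programs -/

/-- Right-hand sides of productions: a terminal character `a`, a pair `X_l X_r` of variables,
or a run `X^k` of a variable. -/
inductive Expr (α : Type*) where
  | char (a : α) : Expr α
  | pair (l r : ℕ) : Expr α
  | pow (b k : ℕ) : Expr α

/-- `x.Mentions c`: the variable `c` appears in the right-hand side `x`. -/
def Expr.Mentions {α : Type*} : Expr α → ℕ → Prop
  | .char _, _ => False
  | .pair l r, c => c = l ∨ c = r
  | .pow b _, c => c = b

/-- A run-length straight-line program over the alphabet `α`. The variables are positive integers,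
`rhs e` is the right-hand side of the production of the variable `e` (irrelevant for `e ∉ vars`),
and `idx e` is the index of `e` in the enumeration of the variables: a right-hand side only
mentions variables of smaller index. There are neither redundant nor useless variables. -/
structure RLSLP (α : Type*) where
  vars : Finset ℕ
  rhs : ℕ → Expr α
  start : ℕ
  idx : ℕ → ℕ
  start_mem : start ∈ vars
  var_pos : ∀ e ∈ vars, 1 ≤ e
  mem_of_mentions : ∀ e ∈ vars, ∀ c, (rhs e).Mentions c → c ∈ vars
  idx_lt_of_mentions : ∀ e ∈ vars, ∀ c, (rhs e).Mentions c → idx c < idx e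
  exponent_pos : ∀ e ∈ vars, ∀ b k, rhs e = .pow b k → 1 ≤ k
  not_redundant : ∀ e ∈ vars, ∀ e' ∈ vars, rhs e = rhs e' → e = e'
  not_useless : ∀ e ∈ vars, Relation.ReflTransGen (fun x c => (rhs x).Mentions c) start e

namespace RLSLP

variable {α : Type*} (G : RLSLP α)

/-- The string derived by a variable (the empty string for an integer that is no variable). -/
def val (e : ℕ) : List α :=
  if he : e ∈ G.vars then
    match hx : G.rhs e with
    | .char a => [a]
    | .pair l r => val l ++ val r
    | .pow b k => (List.replicate k (val b)).flatten
  else []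
termination_by G.idx e
decreasing_by
  all_goals
    apply G.idx_lt_of_mentions e he
    rw [hx]
    simp [Expr.Mentions]

theorem val_char {e : ℕ} (he : e ∈ G.vars) {a : α} (h : G.rhs e = .char a) :
    G.val e = [a] := by
  rw [val, dif_pos he]; split <;> simp_all

theorem val_pair {e : ℕ} (he : e ∈ G.vars) {l r : ℕ} (h : G.rhs e = .pair l r) :
    G.val e = G.val l ++ G.val r := by
  rw [val, dif_pos he]; split <;> simp_all

theorem val_pow {e : ℕ} (he : e ∈ G.vars) {b k : ℕ} (h : G.rhs e = .pow b k) :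
    G.val e = (List.replicate k (G.val b)).flatten := by
  rw [val, dif_pos he]; split <;> simp_all

/-- The string derived by a sequence of variables. -/
def valSeq (u : List ℕ) : List α := u.flatMap G.val

/-- The left string of a variable: `val X_l` for `X → X_l X_r`, and `val Y` for `X → Y^k`.
Variables `X → a` have no left and right string; the empty string stands for them. -/
def left (e : ℕ) : List α :=
  match G.rhs e with
  | .char _ => []
  | .pair l _ => G.val l
  | .pow b _ => G.val b

/-- The right string of a variable: `val X_r` for `X → X_l X_r`, and `(val Y)^(k-1)` for
`X → Y^k`. -/
def right (e : ℕ) : List α :=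
  match G.rhs e with
  | .char _ => []
  | .pair _ r => G.val r
  | .pow b k => (List.replicate (k - 1) (G.val b)).flatten

/-- `pOccAt P j`: the primary occurrences `(X, |X.left| - |P₁| + 1)` of `P` with `|P₁| = j`, where
`P = P₁P₂`, `1 ≤ |P₁| < |P|`, `P₁` is a suffix of `X.left` and `P₂` is a prefix of `X.right`. -/
def pOccAt (P : List α) (j : ℕ) : Set (ℕ × ℕ) :=
  {q | q.1 ∈ G.vars ∧ ∃ P₁ P₂ : List α, P = P₁ ++ P₂ ∧ P₁.length = j ∧
    1 ≤ P₁.length ∧ P₁.length < P.length ∧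
    P₁ <:+ G.left q.1 ∧ P₂ <+: G.right q.1 ∧
    q.2 = (G.left q.1).length - P₁.length + 1}

/-- The set of all primary occurrences of `P`. -/
def pOcc (P : List α) : Set (ℕ × ℕ) :=
  ⋃ j ∈ Set.Ico 1 P.length, G.pOccAt P j

open Classical in
/-- `sig x` is the variable whose right-hand side is `x`. If there is none then `sig x` is
undefined, which is encoded by the value `0`, never a variable. -/
noncomputable def sig (x : Expr α) : ℕ :=
  if h : ∃ e ∈ G.vars, G.rhs e = x then h.choose else 0

/-- `Sig` of a block of variables, applied to pairs from left to right:
`Sig (x₁ ⋯ x_m) = Sig (Sig (x₁ ⋯ x_(m-1)) x_m)`. -/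
noncomputable def sigBlock : List ℕ → ℕ
  | [] => 0
  | x :: xs => xs.foldl (fun acc y => G.sig (.pair acc y)) x

/-- `Sig` of a run `x^k`, given as the list of its `k` equal elements. -/
noncomputable def sigRun (b : List ℕ) : ℕ := G.sig (.pow (b.headD 0) b.length)

end RLSLP

/-! ### Locally consistent parsing -/

/-- The iterated logarithm `log* n`: the least `k` such that applying `log₂` `k` times to `n`
gives a number at most `1`. -/
noncomputable def logStar (n : ℕ) : ℕ :=
  sInf {k : ℕ | (Real.logb 2)^[k] (n : ℝ) ≤ 1}

/-- `Δ_L = log* W + 6`. -/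
noncomputable def deltaL (W : ℕ) : ℕ := logStar W + 6

/-- `Δ_R = 4`. -/
def deltaR : ℕ := 4

/-- A `0`-`1`-valued function of windows of `log* W + 11 = Δ_L + 1 + Δ_R` integers. Only its values
on windows with entries in `[0..W]` matter. -/
abbrev WindowFun (W : ℕ) : Type := (Fin (logStar W + 11) → ℕ) → Bool

/-- The bit sequence `d` of a sequence `p`, indexed from `0`: `d i` is the value of `f` at
`(p̃ (i - Δ_L), …, p̃ (i + Δ_R))`, where `p̃` continues `p` by zeros on both sides. -/
noncomputable def bits {W : ℕ} (f : WindowFun W) (p : List ℕ) (i : ℕ) : Bool :=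
  f fun k => if deltaL W ≤ i + k then p.getD (i + k - deltaL W) 0 else 0

/-- `f` is a function for locally consistent parsing over `[1..W]`: for each sequence `p` over
`[1..W]` of length `n ≥ 2` without equal neighbours, the bit sequence `d` of `p` satisfies
(in indices from `1`) `d[1] = 1`, `d[n] = 0`, `d[i] + d[i+1] ≤ 1` for `1 ≤ i < n`, and
`d[i] + d[i+1] + d[i+2] + d[i+3] ≥ 1` for `1 ≤ i < n - 3`. -/
def IsLocallyConsistent {W : ℕ} (f : WindowFun W) : Prop :=
  ∀ p : List ℕ, 2 ≤ p.length → (∀ x ∈ p, 1 ≤ x ∧ x ≤ W) → p.IsChain (· ≠ ·) →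
    bits f p 0 = true ∧
    bits f p (p.length - 1) = false ∧
    (∀ i, i + 1 < p.length → ¬ (bits f p i = true ∧ bits f p (i + 1) = true)) ∧
    (∀ i, i + 4 < p.length →
      bits f p i = true ∨ bits f p (i + 1) = true ∨
      bits f p (i + 2) = true ∨ bits f p (i + 3) = true)

/-- The decomposition of `p` into blocks according to `d`, where `p` is regarded as the part of a
longer sequence that starts at position `k`: a new block starts exactly at the positions `i` with
`d i = 1` (and at the beginning of `p`). -/
def eblock (d : ℕ → Bool) (k : ℕ) (p : List ℕ) : List (List ℕ) :=
  ((p.zipIdx k).splitBy fun _ y => !d y.2).map fun b => b.map Prod.fst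

/-- The run-length encoding: the list of the maximal runs of `s`, each run `a^k` written as the
list of its `k` equal elements. -/
def epow (s : List ℕ) : List (List ℕ) := s.splitBy (· == ·)

/-! ### Signature encodings -/

section

variable {α : Type*} {M : ℕ} (f : WindowFun M) (G : RLSLP α)

/-- From `Shrink_t` to `Pow_t`, and from `XShrink_t` without its first and last run to `XPow_t`. -/
noncomputable def powOf (s : List ℕ) : List ℕ := (epow s).map G.sigRun

/-- `Shrink_t` of a string. -/
noncomputable def shrink (T : List α) : ℕ → List ℕ
  | 0 => T.map fun a => G.sig (.char a)
  | t + 1 => (eblock (bits f (powOf G (shrink T t))) 0 (powOf G (shrink T t))).map G.sigBlock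

/-- `Pow_t` of a string. -/
noncomputable def pow (T : List α) (t : ℕ) : List ℕ := powOf G (shrink f G T t)

/-- `G` is the signature encoding of the nonempty string `T`, where `4|T| ≤ M`, the signatures
are in `[1..M-1]`, and the parsing uses the function `f`: with the least `h` such that
`|Pow_h| = 1`, all signatures in `Shrink_t` and `Pow_t` for `t ≤ h` are defined, and `Pow_h`
consists of the start symbol. (The variables of an `RLSLP` are useful, so that `G` has
no other productions than those used by the derivation of its start symbol.) -/
def IsSignatureEncoding (T : List α) : Prop :=
  T ≠ [] ∧ 4 * T.length ≤ M ∧ (∀ e ∈ G.vars, e < M) ∧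
  ∃ h : ℕ, (pow f G T h).length = 1 ∧ (∀ t < h, (pow f G T t).length ≠ 1) ∧
    (∀ t ≤ h, (∀ e ∈ shrink f G T t, e ∈ G.vars) ∧ (∀ e ∈ pow f G T t, e ∈ G.vars)) ∧
    pow f G T h = [G.start]

/-! ### Common sequences -/

/-- The longest prefix of `s` that is a single run. -/
def hatL (s : List ℕ) : List ℕ := (epow s).headD []

/-- The longest suffix of `s` that is a single run. -/
def hatR (s : List ℕ) : List ℕ := (epow s).getLastD []

/-- `s` without its first and its last run. -/
def hatCore (s : List ℕ) : List ℕ :=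
  (s.drop (hatL s).length).take (s.length - (hatL s).length - (hatR s).length)

/-- The length of the shortest prefix of `p` of length at least `Δ_L` that is followed by the
start of a block. -/
noncomputable def lenL (p : List ℕ) : ℕ :=
  sInf {l | deltaL M ≤ l ∧ l < p.length ∧ bits f p l = true}

/-- The length of the shortest suffix of `p` of length at least `Δ_R + 1` that starts with the
start of a block. -/
noncomputable def lenR (p : List ℕ) : ℕ :=
  sInf {r | deltaR + 1 ≤ r ∧ r ≤ p.length ∧ bits f p (p.length - r) = true}

/-- The blocks of `p` between its prefix of length `lenL` and its suffix of length `lenR`. -/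
noncomputable def innerBlocks (p : List ℕ) : List (List ℕ) :=
  eblock (bits f p) (lenL f p) ((p.drop (lenL f p)).take (p.length - lenL f p - lenR f p))

/-- `XShrink_t` of a string. -/
noncomputable def xshrink (P : List α) : ℕ → List ℕ
  | 0 => P.map fun a => G.sig (.char a)
  | t + 1 => (innerBlocks f (powOf G (hatCore (xshrink P t)))).map G.sigBlock

/-- `XPow_t` of a string. -/
noncomputable def xpow (P : List α) (t : ℕ) : List ℕ := powOf G (hatCore (xshrink f G P t))

/-- `h^P`: the least level at which `XShrink` has at most `Δ_L + Δ_R + 9` runs. -/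
noncomputable def hP (P : List α) : ℕ :=
  sInf {h | (epow (xshrink f G P h)).length ≤ deltaL M + deltaR + 9}

/-- The prefix `L_t` of `XPow_t`. -/
noncomputable def seqL (P : List α) (t : ℕ) : List ℕ :=
  (xpow f G P t).take (lenL f (xpow f G P t))

/-- The suffix `R_t` of `XPow_t`. -/
noncomputable def seqR (P : List α) (t : ℕ) : List ℕ :=
  (xpow f G P t).drop ((xpow f G P t).length - lenR f (xpow f G P t))

/-- The common sequence
`L̂_0 L_0 ⋯ L̂_(h-1) L_(h-1) XShrink_h R_(h-1) R̂_(h-1) ⋯ R_0 R̂_0` of `P`, where `h = h^P`. -/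
noncomputable def uniq (P : List α) : List ℕ :=
  ((List.range (hP f G P)).flatMap fun t => hatL (xshrink f G P t) ++ seqL f G P t) ++
  xshrink f G P (hP f G P) ++
  ((List.range (hP f G P)).reverse.flatMap fun t => seqR f G P t ++ hatR (xshrink f G P t))

/-- The set `{ |val(u[1..i])| : 1 ≤ i < |u|, u[i] ≠ u[i+1] }` (below, `i` counts from `0`). -/
def splitPoints (u : List ℕ) : Finset ℕ :=
  ((Finset.range (u.length - 1)).filter fun i => u.getD i 0 ≠ u.getD (i + 1) 0).image
    fun i => (G.valSeq (u.take (i + 1))).length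

end

end SigEnc

namespace SigEnc

/-! ### Run-length encoding -/

/-! Measure each border between neighbouring variables of a level of `T` by the length of the text
to its left; these numbers are the cuts of the level. Passing from `Shrink_t` to `Pow_t` to
`Shrink_(t+1)` only merges neighbours, so cuts only disappear. Every variable is used in the
derivation of `T`, so a primary occurrence of `P` yields an occurrence of `P` in `T`, and its split
point is a cut of the last level that cuts this occurrence (`Encodes.exists_occurrence`). That level
is either some `Shrink_t`, and then the split is the leftmost of its cuts inside the occurrence, or
some `Pow_t`.

The parsing bits depend on bounded windows, so away from its ends `P` is parsed alike in every
context (`eblock_bits_append_append`, `Encodes.step`). With `n = h^P`, this makes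
`Encodes.commonSeq_spec` work by induction on `n`: if `n > 0`, then `Shrink_n` still cuts the
occurrence, so no lower level can be the last one; and every cut of `Shrink_n` inside the occurrence
separates unequal elements of `Uniq(P)`, unless it lies inside a run of `Shrink_n` and, for `n > 0`,
is not the leftmost cut. A split point is never such an exception: at a level above `n` it is a cut
of `Pow_n`, at level `n > 0` it is leftmost or a cut of `Pow_n`, and inside a run at level `0` it
would make `P` a power of one character (`Encodes.goodCut_uniq`).

For the count, all blocks have at least two elements, so lengths halve from level to level and `2^n
≤ |P|`. Each level adds at most `Δ_L + 13` runs to `Uniq(P)`, the top has at most `Δ_L + Δ_R + 9`,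
and split points are borders of runs (`commonSeq_bounds`, `HasRuns.card_filter_le`). -/

theorem epow_flatten (s : List ℕ) : (epow s).flatten = s := List.flatten_splitBy _ _

theorem epow_nil : epow [] = [] := List.splitBy_nil _

theorem ne_nil_of_mem_epow {s b : List ℕ} (h : b ∈ epow s) : b ≠ [] :=
  List.ne_nil_of_mem_splitBy h

theorem isChain_of_mem_epow {s b : List ℕ} (h : b ∈ epow s) : b.IsChain (· = ·) := by
  simpa using List.isChain_of_mem_splitBy h

theorem eq_replicate_of_isChain_eq {b : List ℕ} (h : b.IsChain (· = ·)) :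
    b = List.replicate b.length (b.headD 0) := by
  rw [List.isChain_iff_pairwise] at h
  rw [List.eq_replicate_iff]
  refine ⟨rfl, ?_⟩
  cases b with
  | nil => simp
  | cons a b =>
    intro c hc
    rcases List.mem_cons.1 hc with rfl | hc
    · rfl
    · simpa using (List.rel_of_pairwise_cons h hc).symm

theorem isChain_eq_replicate (n a : ℕ) : (List.replicate n a).IsChain (· = ·) :=
  List.isChain_replicate_of_rel n rfl

theorem getLast?_eq_head?_of_isChain_eq {p q : List ℕ} (h : (p ++ q).IsChain (· = ·))
    (hp : p ≠ []) (hq : q ≠ []) : p.getLast? = q.head? := by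
  rw [List.isChain_append] at h
  obtain ⟨x, hx⟩ := List.getLast?_isSome.2 hp |> Option.isSome_iff_exists.1
  obtain ⟨y, hy⟩ := List.isSome_head?.2 hq |> Option.isSome_iff_exists.1
  rw [hx, hy, h.2.2 x hx y hy]

theorem epow_of_isChain_eq {b : List ℕ} (hb : b ≠ []) (h : b.IsChain (· = ·)) :
    epow b = [b] :=
  List.splitBy_of_isChain hb (by simpa using h)

theorem epow_append {l m : List ℕ} (h : l ≠ [] → m ≠ [] → l.getLast? ≠ m.head?) :
    epow (l ++ m) = epow l ++ epow m := by
  apply List.splitBy_append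
  intro x hx y hy
  have hl : l ≠ [] := by rintro rfl; simp at hx
  have hm : m ≠ [] := by rintro rfl; simp at hy
  have := h hl hm
  rw [Option.mem_def.1 hx, Option.mem_def.1 hy] at this
  simpa using this

/-- Maximality of runs, stated for an arbitrary split of the list of runs: this is the form in which
a cut of a `Pow` level presents itself. -/
theorem getLast?_flatten_ne_head?_flatten {s : List ℕ} {E₁ E₂ : List (List ℕ)}
    (h : epow s = E₁ ++ E₂) (h₁ : E₁ ≠ []) (h₂ : E₂ ≠ []) :
    E₁.flatten.getLast? ≠ E₂.flatten.head? := by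
  have hc := List.isChain_getLast_head_splitBy (fun a b : ℕ => a == b) s
  change (epow s).IsChain _ at hc
  rw [h, List.isChain_append] at hc
  obtain ⟨E, b, rfl⟩ := (List.eq_nil_or_concat E₁).resolve_left h₁
  obtain ⟨c, F, rfl⟩ := List.exists_cons_of_ne_nil h₂
  obtain ⟨ha, hb, hab⟩ := hc.2.2 b (by simp) c (by simp)
  simp only [List.concat_eq_append, List.flatten_append, List.flatten_cons, List.flatten_nil,
    List.append_nil, List.getLast?_append_of_ne_nil _ ha, List.head?_append_of_ne_nil _ hb]
  rw [List.getLast?_eq_some_getLast ha, List.head?_eq_some_head hb]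
  simpa using hab

theorem epow_eq_of_two_le {s : List ℕ} (h : 2 ≤ (epow s).length) :
    epow s = hatL s :: (epow (hatCore s) ++ [hatR s]) ∧ s = hatL s ++ hatCore s ++ hatR s := by
  obtain ⟨E, c, hE⟩ := (List.eq_nil_or_concat (epow s)).resolve_left
    (by rintro h0; simp [h0] at h)
  obtain ⟨a, F, rfl⟩ := List.exists_cons_of_ne_nil (l := E)
    (by rintro rfl; simp [hE] at h)
  simp only [List.concat_eq_append, List.cons_append] at hE
  have hL : hatL s = a := by simp [hatL, hE]
  have hR : hatR s = c := by
    rw [hatR, hE, ← List.cons_append, List.getLastD_concat]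
  have hs : s = a ++ F.flatten ++ c := by
    conv_lhs => rw [← epow_flatten s, hE]
    simp
  have hC : hatCore s = F.flatten := by
    rw [hatCore, hL, hR]
    conv_lhs => rw [hs]
    simp
  have hF : epow F.flatten = F := by
    have := (List.splitBy_eq_iff (r := fun a b : ℕ => a == b)).1 hE
    refine (List.splitBy_eq_iff).2 ⟨rfl, ?_, ?_, ?_⟩
    · intro h'; exact this.2.1 (by simp [h'])
    · intro m hm; exact this.2.2.1 m (by simp [hm])
    · exact this.2.2.2.infix ⟨[a], [c], by simp⟩
  rw [hC, hL, hR, hF]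
  exact ⟨hE, hs⟩

theorem hatL_isChain (s : List ℕ) : (hatL s).IsChain (· = ·) := by
  unfold hatL
  cases h : epow s with
  | nil => simp
  | cons a l => exact isChain_of_mem_epow (s := s) (by simp [h])

theorem hatR_isChain (s : List ℕ) : (hatR s).IsChain (· = ·) := by
  unfold hatR
  rcases List.eq_nil_or_concat (epow s) with h | ⟨E, c, h⟩
  · simp [h]
  · rw [h]
    simpa using isChain_of_mem_epow (s := s) (b := c) (by simp [h])

theorem hatL_ne_nil {s : List ℕ} (h : 2 ≤ (epow s).length) : hatL s ≠ [] :=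
  ne_nil_of_mem_epow (s := s) (by rw [(epow_eq_of_two_le h).1]; simp)

theorem hatR_ne_nil {s : List ℕ} (h : 2 ≤ (epow s).length) : hatR s ≠ [] :=
  ne_nil_of_mem_epow (s := s) (by rw [(epow_eq_of_two_le h).1]; simp)

/-- The maximal runs of the core of `s` are maximal runs in every sequence that contains `s`. -/
theorem epow_append_append {s : List ℕ} (h : 2 ≤ (epow s).length) (A B : List ℕ) :
    epow (A ++ s ++ B) =
      epow (A ++ hatL s) ++ epow (hatCore s) ++ epow (hatR s ++ B) := by
  obtain ⟨hE, hs⟩ := epow_eq_of_two_le h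
  have hL := hatL_ne_nil h
  have hR := hatR_ne_nil h
  have b₁ := getLast?_flatten_ne_head?_flatten (E₁ := [hatL s])
    (E₂ := epow (hatCore s) ++ [hatR s]) hE (by simp) (by simp)
  have b₂ := getLast?_flatten_ne_head?_flatten (E₁ := hatL s :: epow (hatCore s))
    (E₂ := [hatR s]) (by rw [hE]; simp) (by simp) (by simp)
  simp only [List.flatten_cons, List.flatten_nil, List.append_nil, List.flatten_append,
    epow_flatten] at b₁ b₂
  have e : A ++ s ++ B = A ++ hatL s ++ (hatCore s ++ (hatR s ++ B)) := by
    conv_lhs => rw [hs]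
    simp
  rw [e, epow_append (l := A ++ hatL s), epow_append (l := hatCore s), List.append_assoc]
  · intro hc _
    rwa [List.head?_append_of_ne_nil _ hR, ← List.getLast?_append_of_ne_nil (hatL s) hc]
  · intro _ _
    rw [List.getLast?_append_of_ne_nil _ hL]
    rwa [← List.append_assoc, List.head?_append_of_ne_nil _ (by simp [hR])]

/-! ### Blocks -/

theorem eblock_nil (d : ℕ → Bool) (k : ℕ) : eblock d k [] = [] := by simp [eblock]

theorem eblock_append {d : ℕ → Bool} {k : ℕ} {p : List ℕ} (q : List ℕ)
    (h : q ≠ [] → d (k + p.length) = true) :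
    eblock d k (p ++ q) = eblock d k p ++ eblock d (k + p.length) q := by
  unfold eblock
  rw [List.zipIdx_append, List.splitBy_append, List.map_append]
  intro x _ y hy
  cases q with
  | nil => simp at hy
  | cons a q =>
    simp only [List.zipIdx_cons, List.head?_cons, Option.mem_def, Option.some.injEq] at hy
    simp [← hy, h]

theorem eblock_single {d : ℕ → Bool} {k : ℕ} {u : List ℕ} (hu : u ≠ [])
    (h : ∀ i, 0 < i → i < u.length → d (k + i) = false) : eblock d k u = [u] := by
  unfold eblock
  rw [List.splitBy_of_isChain]
  · simp [List.zipIdx_map_fst]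
  · simpa using hu
  · rw [List.isChain_iff_getElem]
    intro i hi
    simp only [List.length_zipIdx] at hi
    simp [h (i + 1) (by omega) hi]

/-- Splitting before the first block start after position `k` peels off one block; the inductions on
blocks below run on this. -/
theorem exists_first_block (d : ℕ → Bool) (k : ℕ) {w : List ℕ} (hw : w ≠ []) :
    ∃ u v, w = u ++ v ∧ u ≠ [] ∧ (∀ i, 0 < i → i < u.length → d (k + i) = false) ∧
      (v ≠ [] → d (k + u.length) = true) := by
  by_cases h : ∃ i, 0 < i ∧ i < w.length ∧ d (k + i) = true
  · classical
    have hspec := Nat.find_spec h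
    obtain ⟨h1, h2, h3⟩ := hspec
    have hl : (w.take (Nat.find h)).length = Nat.find h :=
      List.length_take_of_le (by omega)
    refine ⟨w.take (Nat.find h), w.drop (Nat.find h), by simp, ?_, ?_, ?_⟩
    · intro h'; rw [h', List.length_nil] at hl; omega
    · intro i hi hi'
      rw [hl] at hi'
      have := Nat.find_min h hi'
      by_contra hd
      exact this ⟨hi, by omega, by simpa using hd⟩
    · intro _; rw [hl]; exact h3
  · refine ⟨w, [], by simp, hw, ?_, by simp⟩
    intro i hi hi'
    by_contra hd
    exact h ⟨i, hi, hi', by simpa using hd⟩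

theorem eblock_first {d : ℕ → Bool} {k : ℕ} {u v : List ℕ} (hu : u ≠ [])
    (h : ∀ i, 0 < i → i < u.length → d (k + i) = false)
    (hv : v ≠ [] → d (k + u.length) = true) :
    eblock d k (u ++ v) = u :: eblock d (k + u.length) v := by
  rw [eblock_append v hv, eblock_single hu h]; rfl

theorem eblock_flatten (d : ℕ → Bool) (k : ℕ) (w : List ℕ) : (eblock d k w).flatten = w := by
  rw [eblock, ← List.map_flatten, List.flatten_splitBy, List.zipIdx_map_fst]

/-- Offsets may differ, so that a part of `P` can be compared with the same part seen inside a level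
of `T`. -/
theorem eblock_congr {d d' : ℕ → Bool} {w : List ℕ} : ∀ {k k' : ℕ},
    (∀ i < w.length, d (k + i) = d' (k' + i)) → eblock d k w = eblock d' k' w := by
  induction hn : w.length using Nat.strong_induction_on generalizing w with
  | _ n IH =>
    intro k k' h
    by_cases hw : w = []
    · simp [hw, eblock_nil]
    obtain ⟨u, v, rfl, hu, hi, hv⟩ := exists_first_block d k hw
    have hu' := List.length_pos_iff.2 hu
    simp only [List.length_append] at hn
    rw [eblock_first hu hi hv, eblock_first (d := d') (k := k') hu,
      IH v.length (by omega) rfl (k' := k' + u.length)]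
    · intro i hlt
      have := h (u.length + i) (by omega)
      rwa [← add_assoc, ← add_assoc] at this
    · intro i h0 hlt; rw [← h i (by omega), hi i h0 hlt]
    · intro hv0
      have := List.length_pos_iff.2 hv0
      rw [← h _ (by omega), hv hv0]

/-- Every block has at least two elements if no block start is followed by another one or by the
end of the sequence. -/
theorem two_le_length_of_mem_eblock {d : ℕ → Bool} {w : List ℕ} : ∀ {k : ℕ},
    d k = true → (∀ i < w.length, d (k + i) = true → i + 1 < w.length ∧ d (k + i + 1) = false) →
    ∀ b ∈ eblock d k w, 2 ≤ b.length := by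
  induction hn : w.length using Nat.strong_induction_on generalizing w with
  | _ n IH =>
    intro k hk h b hb
    by_cases hw : w = []
    · simp [hw, eblock_nil] at hb
    obtain ⟨u, v, rfl, hu, hi, hv⟩ := exists_first_block d k hw
    have hu' := List.length_pos_iff.2 hu
    simp only [List.length_append] at hn
    rw [eblock_first hu hi hv] at hb
    rcases List.mem_cons.1 hb with rfl | hb
    · by_contra hlt
      have h1 : b.length = 1 := by omega
      -- A block of length one would be a start that is followed by another start or by the end.
      obtain ⟨h2, h3⟩ := h 0 (by omega) (by simpa using hk)
      have := hv (by rintro rfl; simp at hn; omega)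
      rw [h1] at this
      simp only [add_zero] at h3
      simp [h3] at this
    · have hv0 : v ≠ [] := by rintro rfl; simp [eblock_nil] at hb
      refine IH v.length (by omega) rfl (hv hv0) ?_ b hb
      intro i hlt hd
      have := h (u.length + i) (by omega) (by rwa [← add_assoc])
      rw [← add_assoc] at this
      exact ⟨by omega, this.2⟩

theorem ne_nil_of_mem_eblock {d : ℕ → Bool} {k : ℕ} {w b : List ℕ} (hb : b ∈ eblock d k w) :
    b ≠ [] := by
  obtain ⟨c, hc, rfl⟩ := List.mem_map.1 hb
  simpa using List.ne_nil_of_mem_splitBy hc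

theorem mul_length_le_length_flatten {k : ℕ} {E : List (List ℕ)} (h : ∀ b ∈ E, k ≤ b.length) :
    k * E.length ≤ E.flatten.length := by
  induction E with
  | nil => simp
  | cons a E IH =>
    have h1 := h a (by simp)
    have h2 := IH fun b hb => h b (by simp [hb])
    simp only [List.length_cons, List.flatten_cons, List.length_append, mul_add]
    omega

/-! ### Signatures and values -/

namespace RLSLP

variable {α : Type*} (G : RLSLP α)

/-- Since `0` is no variable, membership in `G.vars` says exactly that the signature is defined. -/
theorem rhs_sig {x : Expr α} (h : G.sig x ∈ G.vars) : G.rhs (G.sig x) = x := by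
  unfold sig at h ⊢
  split_ifs at h ⊢ with hx
  · exact hx.choose_spec.2
  · exact absurd (G.var_pos 0 h) (by simp)

theorem val_ne_nil {e : ℕ} (he : e ∈ G.vars) : G.val e ≠ [] := by
  induction hn : G.idx e using Nat.strong_induction_on generalizing e with
  | _ n IH =>
    cases hr : G.rhs e with
    | char a => simp [G.val_char he hr]
    | pair l r =>
      have hm : (G.rhs e).Mentions l := by rw [hr]; simp [Expr.Mentions]
      rw [G.val_pair he hr]
      simp [IH _ (hn ▸ G.idx_lt_of_mentions e he l hm) (G.mem_of_mentions e he l hm) rfl]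
    | pow b k =>
      have hm : (G.rhs e).Mentions b := by rw [hr]; simp [Expr.Mentions]
      have hk := G.exponent_pos e he b k hr
      rw [G.val_pow he hr]
      have := IH _ (hn ▸ G.idx_lt_of_mentions e he b hm) (G.mem_of_mentions e he b hm) rfl
      obtain ⟨k, rfl⟩ := Nat.exists_eq_succ_of_ne_zero (by omega : k ≠ 0)
      simp [List.replicate_succ, this]

@[simp] theorem valSeq_nil : G.valSeq [] = [] := rfl

@[simp] theorem valSeq_append (u v : List ℕ) : G.valSeq (u ++ v) = G.valSeq u ++ G.valSeq v := by
  simp [valSeq]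

@[simp] theorem valSeq_cons (e : ℕ) (u : List ℕ) : G.valSeq (e :: u) = G.val e ++ G.valSeq u := by
  simp [valSeq]

theorem valSeq_replicate (k e : ℕ) :
    G.valSeq (List.replicate k e) = (List.replicate k (G.val e)).flatten := by
  simp [valSeq, List.flatMap]

theorem length_valSeq_pos {u : List ℕ} (h : ∀ e ∈ u, e ∈ G.vars) (hu : u ≠ []) :
    0 < (G.valSeq u).length := by
  obtain ⟨e, v, rfl⟩ := List.exists_cons_of_ne_nil hu
  have := List.length_pos_iff.2 (G.val_ne_nil (h e (by simp)))
  simp only [valSeq_cons, List.length_append]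
  omega

theorem valSeq_map {E : List (List ℕ)} {g : List ℕ → ℕ} (h : ∀ b ∈ E, G.val (g b) = G.valSeq b) :
    G.valSeq (E.map g) = G.valSeq E.flatten := by
  induction E with
  | nil => rfl
  | cons b E IH =>
    simp [h b (by simp), IH fun b hb => h b (by simp [hb])]

theorem valSeq_map_sig_char {P : List α} (h : ∀ a ∈ P, G.sig (.char a) ∈ G.vars) :
    G.valSeq (P.map fun a => G.sig (.char a)) = P := by
  induction P with
  | nil => rfl
  | cons a P IH =>
    have ha := h a (by simp)
    simp [G.val_char ha (G.rhs_sig ha), IH fun a ha => h a (by simp [ha])]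

theorem rhs_sigRun {b : List ℕ} (h : G.sigRun b ∈ G.vars) :
    G.rhs (G.sigRun b) = .pow (b.headD 0) b.length :=
  G.rhs_sig h

theorem mem_of_sigRun_mem {b : List ℕ} (hb : b.IsChain (· = ·)) (h : G.sigRun b ∈ G.vars) :
    ∀ e ∈ b, e ∈ G.vars := by
  intro e he
  apply G.mem_of_mentions _ h
  rw [G.rhs_sigRun h]
  rw [eq_replicate_of_isChain_eq hb] at he
  exact (List.mem_replicate.1 he).2

theorem val_sigRun {b : List ℕ} (hb : b.IsChain (· = ·)) (h : G.sigRun b ∈ G.vars) :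
    G.val (G.sigRun b) = G.valSeq b := by
  rw [G.val_pow h (G.rhs_sigRun h)]
  conv_rhs => rw [eq_replicate_of_isChain_eq hb, valSeq_replicate]

theorem sigBlock_singleton (x : ℕ) : G.sigBlock [x] = x := rfl

theorem sigBlock_concat {b : List ℕ} (hb : b ≠ []) (y : ℕ) :
    G.sigBlock (b ++ [y]) = G.sig (.pair (G.sigBlock b) y) := by
  obtain ⟨e, v, rfl⟩ := List.exists_cons_of_ne_nil hb
  simp [sigBlock]

theorem rhs_sigBlock_concat {b : List ℕ} (hb : b ≠ []) {y : ℕ}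
    (h : G.sigBlock (b ++ [y]) ∈ G.vars) :
    G.rhs (G.sigBlock (b ++ [y])) = .pair (G.sigBlock b) y := by
  rw [G.sigBlock_concat hb] at h ⊢
  exact G.rhs_sig h

/-- The production of a block signature mentions the signature of the block without its last
element, so being defined passes down to all prefixes and elements. -/
theorem mem_and_val_of_sigBlock_mem {b : List ℕ} (hb : b ≠ []) (h : G.sigBlock b ∈ G.vars) :
    (∀ e ∈ b, e ∈ G.vars) ∧ G.val (G.sigBlock b) = G.valSeq b := by
  induction b using List.reverseRecOn with
  | nil => simp at hb
  | append_singleton b y IH =>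
    by_cases hb' : b = []
    · subst hb'
      simp only [List.nil_append, sigBlock_singleton] at h
      simp [sigBlock_singleton, h]
    · have hr := G.rhs_sigBlock_concat hb' h
      have h1 : G.sigBlock b ∈ G.vars :=
        G.mem_of_mentions _ h _ (by rw [hr]; simp [Expr.Mentions])
      have h2 : y ∈ G.vars := G.mem_of_mentions _ h _ (by rw [hr]; simp [Expr.Mentions])
      obtain ⟨h3, h4⟩ := IH hb' h1
      refine ⟨?_, ?_⟩
      · intro e he
        rcases List.mem_append.1 he with he | he
        · exact h3 e he
        · simp only [List.mem_singleton] at he; rwa [he]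
      · rw [G.val_pair h hr, h4]; simp

/-- A variable with a run as its right-hand side. -/
def IsPow (e : ℕ) : Prop := ∃ b k, G.rhs e = .pow b k

theorem isPow_sigRun {b : List ℕ} (h : G.sigRun b ∈ G.vars) : G.IsPow (G.sigRun b) :=
  ⟨_, _, G.rhs_sigRun h⟩

theorem not_isPow_sig_char {a : α} (h : G.sig (.char a) ∈ G.vars) :
    ¬ G.IsPow (G.sig (.char a)) := by
  rintro ⟨b, k, hr⟩
  simp [G.rhs_sig h] at hr

theorem exists_eq_concat_of_two_le {b : List ℕ} (hb : 2 ≤ b.length) :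
    ∃ c y, c ≠ [] ∧ b = c ++ [y] := by
  rcases List.eq_nil_or_concat b with rfl | ⟨c, y, rfl⟩
  · simp at hb
  · exact ⟨c, y, by rintro rfl; simp at hb, by simp⟩

/-- Length two is essential: the signature of a one-element block is that element, which may itself
be a run variable. -/
theorem not_isPow_sigBlock {b : List ℕ} (hb : 2 ≤ b.length) (h : G.sigBlock b ∈ G.vars) :
    ¬ G.IsPow (G.sigBlock b) := by
  obtain ⟨c, y, hc, rfl⟩ := exists_eq_concat_of_two_le hb
  rintro ⟨b, k, hr⟩
  simp [G.rhs_sigBlock_concat hc h] at hr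

/-! ### Cuts -/

/-- `c` is the length of the string derived by a prefix of `S`. -/
def Cut (S : List ℕ) (c : ℕ) : Prop := ∃ p q, S = p ++ q ∧ (G.valSeq p).length = c

/-- `c` is the length of the string derived by a proper prefix of `u` that ends between two
different elements. -/
def GoodCut (u : List ℕ) (c : ℕ) : Prop :=
  ∃ p q, u = p ++ q ∧ p ≠ [] ∧ q ≠ [] ∧ p.getLast? ≠ q.head? ∧ (G.valSeq p).length = c

variable {G}

theorem GoodCut.append {u : List ℕ} {c : ℕ} (h : G.GoodCut u c) (l r : List ℕ) :
    G.GoodCut (l ++ u ++ r) ((G.valSeq l).length + c) := by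
  obtain ⟨p, q, rfl, hp, hq, hpq, rfl⟩ := h
  refine ⟨l ++ p, q ++ r, by simp, by simp [hp], by simp [hq], ?_, by simp⟩
  rwa [List.getLast?_append_of_ne_nil _ hp, List.head?_append_of_ne_nil _ hq]

theorem Cut.middle {X Y Z : List ℕ} {p q : List ℕ} (h : X ++ Y ++ Z = p ++ q)
    (h₁ : (G.valSeq X).length < (G.valSeq p).length)
    (h₂ : (G.valSeq p).length < (G.valSeq X).length + (G.valSeq Y).length) :
    ∃ a b, Y = a ++ b ∧ a ≠ [] ∧ b ≠ [] ∧ p = X ++ a ∧ q = b ++ Z := by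
  rw [List.append_assoc, List.append_eq_append_iff] at h
  rcases h with ⟨a, rfl, h⟩ | ⟨a, rfl, h⟩
  · rw [List.append_eq_append_iff] at h
    rcases h with ⟨b, rfl, rfl⟩ | ⟨b, rfl, rfl⟩
    · simp at h₂
    · refine ⟨a, b, rfl, ?_, ?_, rfl, rfl⟩
      · rintro rfl; simp at h₁
      · rintro rfl; simp at h₂
  · simp at h₁

theorem Cut.exists_middle {X Y Z : List ℕ} {c : ℕ} (h : G.Cut (X ++ Y ++ Z) c)
    (h₁ : (G.valSeq X).length < c) (h₂ : c < (G.valSeq X).length + (G.valSeq Y).length) :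
    ∃ a b, Y = a ++ b ∧ a ≠ [] ∧ b ≠ [] ∧ (G.valSeq X).length + (G.valSeq a).length = c := by
  obtain ⟨p, q, h, rfl⟩ := h
  obtain ⟨a, b, hY, ha, hb, rfl, -⟩ := Cut.middle h h₁ h₂
  exact ⟨a, b, hY, ha, hb, by simp⟩

/-- Text derived by a single variable of a level is not cut by this level. -/
theorem not_cut_of_lt {X Z : List ℕ} {e c : ℕ} (h₁ : (G.valSeq X).length < c)
    (h₂ : c < (G.valSeq X).length + (G.val e).length) : ¬ G.Cut (X ++ [e] ++ Z) c := by
  intro h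
  obtain ⟨a, b, h, ha, hb, -⟩ := h.exists_middle h₁ (by simpa using h₂)
  rcases List.append_eq_singleton_iff.1 h.symm with h | h
  · exact ha h.1
  · exact hb h.2

theorem Cut.of_map {E : List (List ℕ)} {g : List ℕ → ℕ}
    (hE : ∀ b ∈ E, G.val (g b) = G.valSeq b) {c : ℕ} (h : G.Cut (E.map g) c) :
    ∃ E₁ E₂, E = E₁ ++ E₂ ∧ (G.valSeq E₁.flatten).length = c := by
  obtain ⟨p, q, h, rfl⟩ := h
  obtain ⟨E₁, E₂, rfl, rfl, rfl⟩ := List.map_eq_append_iff.1 h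
  exact ⟨E₁, E₂, rfl, by rw [G.valSeq_map fun b hb => hE b (by simp [hb])]⟩

theorem Cut.flatten_of_map {E : List (List ℕ)} {g : List ℕ → ℕ}
    (hE : ∀ b ∈ E, G.val (g b) = G.valSeq b) {c : ℕ} (h : G.Cut (E.map g) c) :
    G.Cut E.flatten c := by
  obtain ⟨E₁, E₂, rfl, hc⟩ := h.of_map hE
  exact ⟨E₁.flatten, E₂.flatten, by simp, hc⟩

theorem GoodCut.of_isChain_ne {X Y Z : List ℕ} {c : ℕ} (hY : Y.IsChain (· ≠ ·))
    (h : G.Cut (X ++ Y ++ Z) c)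
    (h₁ : (G.valSeq X).length < c) (h₂ : c < (G.valSeq X).length + (G.valSeq Y).length) :
    ∃ c', (G.valSeq X).length + c' = c ∧ G.GoodCut Y c' := by
  obtain ⟨a, b, rfl, ha, hb, h⟩ := h.exists_middle h₁ h₂
  refine ⟨_, h, a, b, rfl, ha, hb, ?_, rfl⟩
  rw [List.isChain_append] at hY
  obtain ⟨x, hx⟩ := List.getLast?_isSome.2 ha |> Option.isSome_iff_exists.1
  obtain ⟨y, hy⟩ := List.isSome_head?.2 hb |> Option.isSome_iff_exists.1
  rw [hx, hy]
  simpa using hY.2.2 x hx y hy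

end RLSLP

/-! ### Runs -/

section

variable {α : Type*} {G : RLSLP α}

open RLSLP

theorem powOf_ne_nil {s : List ℕ} (h : s ≠ []) : powOf G s ≠ [] := by
  simpa [powOf, epow] using h

theorem length_powOf (s : List ℕ) : (powOf G s).length = (epow s).length := by simp [powOf]

theorem powOf_append_append {s : List ℕ} (h : 2 ≤ (epow s).length) (A B : List ℕ) :
    powOf G (A ++ s ++ B) =
      powOf G (A ++ hatL s) ++ powOf G (hatCore s) ++ powOf G (hatR s ++ B) := by
  rw [powOf, epow_append_append h, List.map_append, List.map_append]; rfl

theorem sigRun_mem_of_powOf {s : List ℕ} (h : ∀ e ∈ powOf G s, e ∈ G.vars) {b : List ℕ}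
    (hb : b ∈ epow s) : G.sigRun b ∈ G.vars :=
  h _ (List.mem_map_of_mem hb)

theorem val_sigRun_of_powOf {s : List ℕ} (h : ∀ e ∈ powOf G s, e ∈ G.vars) :
    ∀ b ∈ epow s, G.val (G.sigRun b) = G.valSeq b := fun _ hb =>
  G.val_sigRun (isChain_of_mem_epow hb) (sigRun_mem_of_powOf h hb)

theorem mem_of_powOf {s : List ℕ} (h : ∀ e ∈ powOf G s, e ∈ G.vars) : ∀ e ∈ s, e ∈ G.vars := by
  intro e he
  rw [← epow_flatten s] at he
  obtain ⟨b, hb, he⟩ := List.mem_flatten.1 he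
  exact G.mem_of_sigRun_mem (isChain_of_mem_epow hb) (sigRun_mem_of_powOf h hb) e he

theorem isPow_of_mem_powOf {s : List ℕ} (h : ∀ e ∈ powOf G s, e ∈ G.vars) :
    ∀ e ∈ powOf G s, G.IsPow e := by
  intro e he
  obtain ⟨b, hb, rfl⟩ := List.mem_map.1 he
  exact G.isPow_sigRun (h _ he)

theorem valSeq_powOf {s : List ℕ} (h : ∀ e ∈ powOf G s, e ∈ G.vars) :
    G.valSeq (powOf G s) = G.valSeq s := by
  rw [powOf, G.valSeq_map (val_sigRun_of_powOf h), epow_flatten]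

/-- Equal signatures of neighbouring runs would have equal right-hand sides, hence equal base
symbols. Without definedness both could be `0`. -/
theorem powOf_isChain {s : List ℕ} (h : ∀ e ∈ powOf G s, e ∈ G.vars) :
    (powOf G s).IsChain (· ≠ ·) := by
  rw [List.isChain_iff_forall_rel_of_append_cons_cons]
  intro x y l₁ l₂ hs hxy
  obtain ⟨E₁, E₂, hE, rfl, h2⟩ := List.map_eq_append_iff.1 hs
  obtain ⟨b, E₃, rfl, rfl, h3⟩ := List.map_eq_cons_iff.1 h2
  obtain ⟨c, E₄, rfl, rfl, rfl⟩ := List.map_eq_cons_iff.1 h3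
  have hb : b ∈ epow s := by simp [hE]
  have hc : c ∈ epow s := by simp [hE]
  have key := getLast?_flatten_ne_head?_flatten (s := s) (E₁ := E₁ ++ [b]) (E₂ := c :: E₄)
    (by simp [hE]) (by simp) (by simp)
  have hb0 := ne_nil_of_mem_epow hb
  have hc0 := ne_nil_of_mem_epow hc
  have e1 := G.rhs_sigRun (sigRun_mem_of_powOf h hb)
  rw [hxy, G.rhs_sigRun (sigRun_mem_of_powOf h hc)] at e1
  simp only [Expr.pow.injEq] at e1
  apply key
  simp only [List.flatten_append, List.flatten_cons, List.flatten_nil, List.append_nil,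
    List.getLast?_append_of_ne_nil _ hb0, List.head?_append_of_ne_nil _ hc0]
  have hbr := eq_replicate_of_isChain_eq (isChain_of_mem_epow hb)
  have hcr := eq_replicate_of_isChain_eq (isChain_of_mem_epow hc)
  have hbl := List.length_pos_iff.2 hb0
  have hcl := List.length_pos_iff.2 hc0
  rw [hbr, hcr, List.getLast?_replicate, List.head?_replicate, e1.1]
  simp [hb0, hc0]

/-- Cuts of a `Pow` level are borders of maximal runs, so they separate unequal symbols one step
below. -/
theorem GoodCut.of_cut_powOf {X Y Z : List ℕ} {c : ℕ}
    (hp : ∀ e ∈ powOf G (X ++ Y ++ Z), e ∈ G.vars) (h : G.Cut (powOf G (X ++ Y ++ Z)) c)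
    (h₁ : (G.valSeq X).length < c) (h₂ : c < (G.valSeq X).length + (G.valSeq Y).length) :
    ∃ c', (G.valSeq X).length + c' = c ∧ G.GoodCut Y c' := by
  obtain ⟨E₁, E₂, hE, rfl⟩ := h.of_map (val_sigRun_of_powOf hp)
  have e : X ++ Y ++ Z = E₁.flatten ++ E₂.flatten := by
    rw [← List.flatten_append, ← hE, epow_flatten]
  obtain ⟨a, b, rfl, ha, hb, h3, h4⟩ := Cut.middle e h₁ h₂
  refine ⟨(G.valSeq a).length, by simp [h3], a, b, rfl, ha, hb, ?_, rfl⟩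
  have := getLast?_flatten_ne_head?_flatten hE (by rintro rfl; simp_all) (by rintro rfl; simp_all)
  rwa [h3, h4, List.getLast?_append_of_ne_nil _ ha, List.head?_append_of_ne_nil _ hb] at this

theorem not_goodCut_of_isChain_eq {s : List ℕ} (hs : s.IsChain (· = ·)) (c : ℕ) :
    ¬ G.GoodCut s c := by
  rintro ⟨p, q, rfl, hp, hq, h, -⟩
  exact h (getLast?_eq_head?_of_isChain_eq hs hp hq)

end

/-! ### Parsing -/

section

variable {α : Type*} {M : ℕ} {f : WindowFun M} {G : RLSLP α}

/-- The two inequalities keep the whole window of position `i` inside `w`, where the context is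
invisible. -/
theorem bits_append_append {A w B : List ℕ} {i : ℕ} (h₁ : deltaL M ≤ i)
    (h₂ : i + deltaR < w.length) : bits f (A ++ w ++ B) (A.length + i) = bits f w i := by
  unfold bits
  congr 1
  funext k
  have hk := k.2
  have hd : deltaL M = logStar M + 6 := rfl
  have hd' : deltaR = 4 := rfl
  rw [if_pos (by omega), if_pos (by omega), List.append_assoc,
    List.getD_append_right _ _ _ _ (by omega), List.getD_append _ _ _ _ (by omega)]
  congr 1
  omega

/-- Sequences to which the locally consistent parsing applies. -/
structure IsParsable (M : ℕ) (w : List ℕ) : Prop where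
  two_le : 2 ≤ w.length
  bounds : ∀ x ∈ w, 1 ≤ x ∧ x ≤ M
  isChain : w.IsChain (· ≠ ·)

theorem two_le_length_of_mem_eblock_bits (hf : IsLocallyConsistent f) {w : List ℕ}
    (hw : IsParsable M w) : ∀ b ∈ eblock (bits f w) 0 w, 2 ≤ b.length := by
  obtain ⟨h1, h2, h3, -⟩ := hf w hw.two_le hw.bounds hw.isChain
  apply two_le_length_of_mem_eblock h1
  intro i hi hd
  simp only [zero_add] at hd ⊢
  have : i + 1 < w.length := by
    by_contra hlt
    have : i = w.length - 1 := by omega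
    rw [this, h2] at hd
    simp at hd
  exact ⟨this, by simpa [hd] using h3 i this⟩

/-- Among any four consecutive bits away from the end one is a start; this also shows that the
infimum defining `lenL` is attained and is not the default value `0`. -/
theorem lenL_spec (hf : IsLocallyConsistent f) {w : List ℕ} (hw : IsParsable M w)
    (hl : deltaL M + deltaR + 8 ≤ w.length) :
    deltaL M ≤ lenL f w ∧ lenL f w ≤ deltaL M + 3 ∧ bits f w (lenL f w) = true := by
  obtain ⟨-, -, -, h4⟩ := hf w hw.two_le hw.bounds hw.isChain
  have : ∃ l, l ≤ deltaL M + 3 ∧ l ∈ {l | deltaL M ≤ l ∧ l < w.length ∧ bits f w l = true} := by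
    rcases h4 (deltaL M) (by omega) with h | h | h | h
    · exact ⟨_, by omega, le_rfl, by omega, h⟩
    · exact ⟨_, by omega, by omega, by omega, h⟩
    · exact ⟨_, by omega, by omega, by omega, h⟩
    · exact ⟨_, by omega, by omega, by omega, h⟩
  obtain ⟨l, hl, hl'⟩ := this
  have hm := Nat.sInf_mem ⟨l, hl'⟩
  exact ⟨hm.1, (Nat.sInf_le hl').trans hl, hm.2.2⟩

theorem lenR_spec (hf : IsLocallyConsistent f) {w : List ℕ} (hw : IsParsable M w)
    (hl : deltaL M + deltaR + 8 ≤ w.length) :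
    deltaR + 1 ≤ lenR f w ∧ lenR f w ≤ deltaR + 4 ∧ bits f w (w.length - lenR f w) = true := by
  obtain ⟨-, -, -, h4⟩ := hf w hw.two_le hw.bounds hw.isChain
  have hR : deltaR = 4 := rfl
  have : ∃ r, r ≤ deltaR + 4 ∧
      r ∈ {r | deltaR + 1 ≤ r ∧ r ≤ w.length ∧ bits f w (w.length - r) = true} := by
    -- The suffix lengths `8, 7, 6, 5` run through `Δ_R + 4, …, Δ_R + 1`.
    rcases h4 (w.length - 8) (by omega) with h | h | h | h
    · exact ⟨8, by omega, by omega, by omega, h⟩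
    · exact ⟨7, by omega, by omega, by omega, by rwa [show w.length - 7 = w.length - 8 + 1 by omega]⟩
    · exact ⟨6, by omega, by omega, by omega, by rwa [show w.length - 6 = w.length - 8 + 2 by omega]⟩
    · exact ⟨5, by omega, by omega, by omega, by rwa [show w.length - 5 = w.length - 8 + 3 by omega]⟩
  obtain ⟨r, hr, hr'⟩ := this
  have hm := Nat.sInf_mem ⟨r, hr'⟩
  exact ⟨hm.1, (Nat.sInf_le hr').trans hr, hm.2.2⟩

variable (f) in
/-- The part of `p` between its prefix of length `lenL` and its suffix of length `lenR`. -/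
noncomputable def innerPart (p : List ℕ) : List ℕ :=
  (p.drop (lenL f p)).take (p.length - lenL f p - lenR f p)

variable (f) in
noncomputable def prefL (p : List ℕ) : List ℕ := p.take (lenL f p)

variable (f) in
noncomputable def suffR (p : List ℕ) : List ℕ := p.drop (p.length - lenR f p)

theorem innerBlocks_flatten (p : List ℕ) : (innerBlocks f p).flatten = innerPart f p :=
  eblock_flatten _ _ _

theorem prefL_append_innerPart_append_suffR {p : List ℕ} (h : lenL f p + lenR f p ≤ p.length) :
    prefL f p ++ innerPart f p ++ suffR f p = p := by
  have h1 : suffR f p = (p.drop (lenL f p)).drop (p.length - lenL f p - lenR f p) := by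
    rw [suffR, List.drop_drop]
    congr 1
    omega
  rw [List.append_assoc, h1, innerPart, List.take_append_drop, prefL, List.take_append_drop]

theorem length_prefL {p : List ℕ} (h : lenL f p + lenR f p ≤ p.length) :
    (prefL f p).length = lenL f p := by
  rw [prefL, List.length_take_of_le (by omega)]

theorem length_suffR {p : List ℕ} (h : lenL f p + lenR f p ≤ p.length) :
    (suffR f p).length = lenR f p := by
  rw [suffR, List.length_drop]; omega

theorem length_innerPart {p : List ℕ} :
    (innerPart f p).length = p.length - lenL f p - lenR f p := by
  rw [innerPart, List.length_take, List.length_drop]; omega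

/-- The bits from `lenL` to `|w| - lenR` are independent of `A` and `B`, and both ends of this range
are block starts, so the blocks in between are blocks of every extension of `w`. -/
theorem eblock_bits_append_append (hf : IsLocallyConsistent f) {w : List ℕ} (hw : IsParsable M w)
    (hl : deltaL M + deltaR + 8 ≤ w.length) (A B : List ℕ) :
    eblock (bits f (A ++ w ++ B)) 0 (A ++ w ++ B) =
      eblock (bits f (A ++ w ++ B)) 0 (A ++ prefL f w) ++ innerBlocks f w ++
      eblock (bits f (A ++ w ++ B)) (A.length + (w.length - lenR f w)) (suffR f w ++ B) := by
  obtain ⟨l1, l2, l3⟩ := lenL_spec hf hw hl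
  obtain ⟨r1, r2, r3⟩ := lenR_spec hf hw hl
  have hlr : lenL f w + lenR f w ≤ w.length := by omega
  set d := bits f (A ++ w ++ B) with hd
  have e : A ++ w ++ B = (A ++ prefL f w) ++ (innerPart f w ++ (suffR f w ++ B)) := by
    conv_lhs => rw [← prefL_append_innerPart_append_suffR hlr]
    simp
  have hd' : ∀ i, lenL f w ≤ i → i ≤ w.length - lenR f w → d (A.length + i) = bits f w i :=
    fun i h1 h2 => bits_append_append (by omega) (by omega)
  rw [e, eblock_append (p := A ++ prefL f w), eblock_append (p := innerPart f w), List.append_assoc]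
  · congr 2
    · apply eblock_congr
      intro i hi
      rw [length_innerPart] at hi
      rw [← hd' _ (by omega) (by omega), List.length_append, length_prefL hlr, zero_add, add_assoc]
    · congr 1
      rw [List.length_append, length_prefL hlr, length_innerPart]
      omega
  · intro _
    rw [List.length_append, length_prefL hlr, length_innerPart, ← r3, ← hd' _ (by omega) (by omega)]
    congr 1
    omega
  · intro _
    rw [List.length_append, length_prefL hlr, zero_add, hd' _ le_rfl (by omega), l3]

theorem two_le_length_of_mem_innerBlocks (hf : IsLocallyConsistent f) {w : List ℕ}
    (hw : IsParsable M w) (hl : deltaL M + deltaR + 8 ≤ w.length) :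
    ∀ b ∈ innerBlocks f w, 2 ≤ b.length := by
  obtain ⟨l1, l2, l3⟩ := lenL_spec hf hw hl
  obtain ⟨r1, r2, r3⟩ := lenR_spec hf hw hl
  obtain ⟨-, -, h3, -⟩ := hf w hw.two_le hw.bounds hw.isChain
  apply two_le_length_of_mem_eblock l3
  change ∀ i < (innerPart f w).length, _ → _ < (innerPart f w).length ∧ _
  intro i hi hd
  rw [length_innerPart] at hi ⊢
  have h4 := h3 (lenL f w + i) (by omega)
  -- The inner part is followed by a block start, so its last element is not one.
  have hne : lenL f w + i + 1 ≠ w.length - lenR f w := by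
    intro h; rw [h, r3] at h4; simp [hd] at h4
  exact ⟨by omega, by simpa [hd] using h4⟩

theorem isParsable_powOf (hG : ∀ e ∈ G.vars, e < M) {s : List ℕ}
    (h : ∀ e ∈ powOf G s, e ∈ G.vars) (hl : 2 ≤ (powOf G s).length) :
    IsParsable M (powOf G s) :=
  ⟨hl, fun x hx => ⟨G.var_pos x (h x hx), (hG x (h x hx)).le⟩, powOf_isChain h⟩

end

open RLSLP

/-! ### The signature encoding of a string -/

section

variable {α : Type*} {M : ℕ}

/-- The signatures of the string `T` are defined up to the level `H`, at which a single one
is left. -/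
structure Encodes (f : WindowFun M) (G : RLSLP α) (T : List α) (H : ℕ) : Prop where
  vars_lt : ∀ e ∈ G.vars, e < M
  shrink_mem : ∀ t ≤ H, ∀ e ∈ shrink f G T t, e ∈ G.vars
  pow_mem : ∀ t ≤ H, ∀ e ∈ pow f G T t, e ∈ G.vars
  two_le : ∀ t < H, 2 ≤ (pow f G T t).length
  pow_top : pow f G T H = [G.start]

variable {f : WindowFun M} {G : RLSLP α} {T : List α} {H : ℕ}

theorem eblock_ne_nil {d : ℕ → Bool} {k : ℕ} {w : List ℕ} (hw : w ≠ []) : eblock d k w ≠ [] := by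
  intro h
  apply hw
  rw [← eblock_flatten d k w, h]
  rfl

theorem shrink_ne_nil (hT : T ≠ []) (t : ℕ) : shrink f G T t ≠ [] := by
  induction t with
  | zero => simpa [shrink] using hT
  | succ t IH => simpa [shrink] using eblock_ne_nil (powOf_ne_nil IH)

theorem IsSignatureEncoding.exists_encodes (h : IsSignatureEncoding f G T) :
    ∃ H, Encodes f G T H := by
  obtain ⟨hT, -, hlt, H, -, h1, h2, h3⟩ := h
  refine ⟨H, hlt, fun t ht => (h2 t ht).1, fun t ht => (h2 t ht).2, fun t ht => ?_, h3⟩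
  have := List.length_pos_iff.2 (powOf_ne_nil (G := G) (shrink_ne_nil (f := f) (G := G) hT t))
  have h4 := h1 t ht
  unfold pow at h4 ⊢
  omega

namespace Encodes

theorem isParsable (hE : Encodes f G T H) {t : ℕ} (ht : t < H) : IsParsable M (pow f G T t) :=
  isParsable_powOf hE.vars_lt (hE.pow_mem t ht.le) (hE.two_le t ht)

/-- The blocks that are replaced by the elements of `Shrink_(t+1)`. -/
theorem two_le_length_of_mem (hf : IsLocallyConsistent f) (hE : Encodes f G T H) {t : ℕ}
    (ht : t < H) :
    ∀ b ∈ eblock (bits f (pow f G T t)) 0 (pow f G T t), 2 ≤ b.length :=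
  two_le_length_of_mem_eblock_bits hf (hE.isParsable ht)

theorem sigBlock_mem (hE : Encodes f G T H) {t : ℕ} (ht : t < H) :
    ∀ b ∈ eblock (bits f (pow f G T t)) 0 (pow f G T t), G.sigBlock b ∈ G.vars := fun _ hb =>
  hE.shrink_mem (t + 1) ht _ (List.mem_map_of_mem hb)

theorem val_sigBlock (hf : IsLocallyConsistent f) (hE : Encodes f G T H) {t : ℕ} (ht : t < H) :
    ∀ b ∈ eblock (bits f (pow f G T t)) 0 (pow f G T t), G.val (G.sigBlock b) = G.valSeq b := by
  intro b hb
  have := hE.two_le_length_of_mem hf ht b hb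
  exact (G.mem_and_val_of_sigBlock_mem (by rintro rfl; simp at this) (hE.sigBlock_mem ht b hb)).2

theorem valSeq_shrink (hf : IsLocallyConsistent f) (hE : Encodes f G T H) {t : ℕ} (ht : t ≤ H) :
    G.valSeq (shrink f G T t) = T := by
  induction t with
  | zero =>
    apply G.valSeq_map_sig_char
    intro a ha
    exact hE.shrink_mem 0 ht _ (List.mem_map_of_mem ha)
  | succ t IH =>
    rw [shrink, ← pow, G.valSeq_map (hE.val_sigBlock hf ht), eblock_flatten,
      pow, valSeq_powOf (hE.pow_mem t (by omega)), IH (by omega)]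

theorem not_isPow_of_mem_shrink (hf : IsLocallyConsistent f) (hE : Encodes f G T H) {t : ℕ}
    (ht : t ≤ H) : ∀ e ∈ shrink f G T t, ¬ G.IsPow e := by
  intro e he
  have hm := hE.shrink_mem t ht e he
  cases t with
  | zero =>
    obtain ⟨a, -, rfl⟩ := List.mem_map.1 he
    exact G.not_isPow_sig_char hm
  | succ t =>
    obtain ⟨b, hb, rfl⟩ := List.mem_map.1 he
    exact G.not_isPow_sigBlock (hE.two_le_length_of_mem hf ht b hb) hm

theorem cut_shrink_of_cut_pow (hE : Encodes f G T H) {t c : ℕ} (ht : t ≤ H)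
    (h : G.Cut (pow f G T t) c) : G.Cut (shrink f G T t) c := by
  have := Cut.flatten_of_map (val_sigRun_of_powOf (hE.pow_mem t ht)) h
  rwa [epow_flatten] at this

theorem cut_pow_of_cut_shrink_succ (hf : IsLocallyConsistent f) (hE : Encodes f G T H) {t c : ℕ}
    (ht : t < H) (h : G.Cut (shrink f G T (t + 1)) c) : G.Cut (pow f G T t) c := by
  have := Cut.flatten_of_map (hE.val_sigBlock hf ht) h
  rwa [eblock_flatten] at this

/-- Higher levels are coarser. -/
theorem cut_shrink_mono (hf : IsLocallyConsistent f) (hE : Encodes f G T H) {t t' c : ℕ}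
    (htt : t ≤ t') (ht : t' ≤ H) (h : G.Cut (shrink f G T t') c) : G.Cut (shrink f G T t) c := by
  induction t', htt using Nat.le_induction with
  | base => exact h
  | succ t' htt IH =>
    exact IH (by omega)
      (hE.cut_shrink_of_cut_pow (by omega) (hE.cut_pow_of_cut_shrink_succ hf ht h))

theorem cut_pow_of_cut_shrink (hf : IsLocallyConsistent f) (hE : Encodes f G T H) {t t' c : ℕ}
    (htt : t < t') (ht : t' ≤ H) (h : G.Cut (shrink f G T t') c) : G.Cut (pow f G T t) c :=
  hE.cut_pow_of_cut_shrink_succ hf (by omega) (hE.cut_shrink_mono hf htt ht h)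

end Encodes

/-! ### Common sequences -/

variable (f G) in
/-- The map from `XShrink_t` to `XShrink_(t+1)`. -/
noncomputable def xnext (s : List ℕ) : List ℕ :=
  (innerBlocks f (powOf G (hatCore s))).map G.sigBlock

variable (M) in
/-- The sequence `s` has so many runs that the common sequence descends to the next level. -/
def IsLong (s : List ℕ) : Prop := deltaL M + deltaR + 9 < (epow s).length

variable (f G) in
/-- The common sequence with `n` levels below the sequence `s` of signatures. -/
noncomputable def commonSeq : ℕ → List ℕ → List ℕ
  | 0, s => s
  | n + 1, s => hatL s ++ prefL f (powOf G (hatCore s)) ++ commonSeq n (xnext f G s) ++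
      suffR f (powOf G (hatCore s)) ++ hatR s

theorem xshrink_eq_iterate (P : List α) (t : ℕ) :
    xshrink f G P t = (xnext f G)^[t] (P.map fun a => G.sig (.char a)) := by
  induction t with
  | zero => rfl
  | succ t IH => rw [Function.iterate_succ_apply', ← IH]; rfl

theorem commonSeq_eq (n : ℕ) (s : List ℕ) :
    commonSeq f G n s =
      ((List.range n).flatMap fun t => hatL ((xnext f G)^[t] s) ++
        prefL f (powOf G (hatCore ((xnext f G)^[t] s)))) ++ (xnext f G)^[n] s ++
      ((List.range n).reverse.flatMap fun t =>
        suffR f (powOf G (hatCore ((xnext f G)^[t] s))) ++ hatR ((xnext f G)^[t] s)) := by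
  induction n generalizing s with
  | zero => simp [commonSeq]
  | succ n IH =>
    rw [commonSeq, IH, List.range_succ_eq_map]
    simp [List.flatMap_map, List.flatMap_append, ← List.map_reverse]

theorem uniq_eq_commonSeq (P : List α) :
    uniq f G P = commonSeq f G (hP f G P) (P.map fun a => G.sig (.char a)) := by
  rw [commonSeq_eq, uniq]
  simp only [← xshrink_eq_iterate]
  rfl

theorem isLong_of_lt_hP {P : List α} {j : ℕ} (hj : j < hP f G P) :
    IsLong M ((xnext f G)^[j] (P.map fun a => G.sig (.char a))) := by
  rw [← xshrink_eq_iterate]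
  have := Nat.notMem_of_lt_sInf hj
  simpa [IsLong] using this

theorem IsLong.two_le {s : List ℕ} (h : IsLong M s) : 2 ≤ (epow s).length := by
  unfold IsLong at h; omega

/-- Removing two of at least `Δ_L + Δ_R + 10` runs leaves `Δ_L + Δ_R + 8`. As `lenL + lenR ≤ Δ_L +
Δ_R + 7`, the inner part stays nonempty. -/
theorem IsLong.length_powOf_hatCore {s : List ℕ} (h : IsLong M s) :
    deltaL M + deltaR + 8 ≤ (powOf G (hatCore s)).length := by
  have h1 := congrArg List.length (epow_eq_of_two_le h.two_le).1
  rw [length_powOf]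
  unfold IsLong at h
  simp only [List.length_cons, List.length_append, List.length_nil] at h1
  omega

/-- One level of the common sequence of a substring of `T`. -/
theorem Encodes.step (hf : IsLocallyConsistent f) (hE : Encodes f G T H) {t : ℕ} (ht : t ≤ H)
    {A s B : List ℕ} (hs : shrink f G T t = A ++ s ++ B) (hl : IsLong M s) :
    t < H ∧ (∀ e ∈ powOf G (hatCore s), e ∈ G.vars) ∧
    (∃ A₁ B₁, pow f G T t = A₁ ++ powOf G (hatCore s) ++ B₁ ∧
      G.valSeq A₁ = G.valSeq (A ++ hatL s)) ∧
    (∃ A₂ B₂, shrink f G T (t + 1) = A₂ ++ xnext f G s ++ B₂ ∧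
      G.valSeq A₂ = G.valSeq (A ++ hatL s ++ prefL f (powOf G (hatCore s)))) ∧
    G.valSeq (xnext f G s) = G.valSeq (innerPart f (powOf G (hatCore s))) := by
  have hp : pow f G T t =
      powOf G (A ++ hatL s) ++ powOf G (hatCore s) ++ powOf G (hatR s ++ B) := by
    rw [pow, hs, powOf_append_append hl.two_le]
  have hmem := hE.pow_mem t ht
  have hw : ∀ e ∈ powOf G (hatCore s), e ∈ G.vars := fun e he => hmem e (by simp [hp, he])
  have hA : ∀ e ∈ powOf G (A ++ hatL s), e ∈ G.vars := fun e he => hmem e (by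
    rw [hp, List.append_assoc]; exact List.mem_append_left _ he)
  have hwl := hl.length_powOf_hatCore (G := G)
  -- The top level `Pow_H` is a single variable and has no room for this factor.
  have htH : t < H := by
    refine lt_of_le_of_ne ht ?_
    rintro rfl
    have := congrArg List.length hp
    rw [hE.pow_top] at this
    simp only [List.length_append, List.length_singleton] at this
    omega
  have hpar : IsParsable M (powOf G (hatCore s)) := isParsable_powOf hE.vars_lt hw (by omega)
  have hb := eblock_bits_append_append hf hpar hwl (powOf G (A ++ hatL s)) (powOf G (hatR s ++ B))
  have hv := hE.val_sigBlock hf htH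
  rw [hp] at hv
  have hbm := congrArg (List.map G.sigBlock) hb
  rw [List.map_append, List.map_append] at hbm
  refine ⟨htH, hw, ⟨_, _, hp, valSeq_powOf hA⟩,
    ⟨_, _, by rw [shrink, ← pow, hp]; exact hbm, ?_⟩, ?_⟩
  · rw [G.valSeq_map, eblock_flatten, valSeq_append, valSeq_powOf hA, valSeq_append _ (A ++ _)]
    intro b hb'
    apply hv
    rw [hb, List.append_assoc]
    exact List.mem_append_left _ hb'
  · rw [xnext, G.valSeq_map, innerBlocks_flatten]
    intro b hb'
    apply hv
    rw [hb]
    simp [hb']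

theorem goodCut_append {φ : ℕ → Prop} {p q : List ℕ} (hp : p ≠ []) (hq : q ≠ [])
    (h₁ : ∀ e ∈ p.getLast?, φ e) (h₂ : ∀ e ∈ q.head?, ¬ φ e) :
    G.GoodCut (p ++ q) (G.valSeq p).length := by
  refine ⟨p, q, rfl, hp, hq, ?_, rfl⟩
  intro h
  obtain ⟨x, hx⟩ := List.getLast?_isSome.2 hp |> Option.isSome_iff_exists.1
  exact h₂ x (h ▸ hx) (h₁ x hx)

/-- What the common sequence of an occurrence of a substring of `T` satisfies: it derives the
substring, and it cuts the substring, between different elements, wherever the higher levels of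
`T` do, except possibly at the first cut of its top level. -/
theorem Encodes.commonSeq_spec (hf : IsLocallyConsistent f) (hE : Encodes f G T H) (n : ℕ) :
    ∀ {t : ℕ} {A s B : List ℕ}, t ≤ H → shrink f G T t = A ++ s ++ B → s ≠ [] →
    (∀ j < n, IsLong M ((xnext f G)^[j] s)) →
    t + n ≤ H ∧ (∀ e ∈ commonSeq f G n s, e ∈ G.vars) ∧
    G.valSeq (commonSeq f G n s) = G.valSeq s ∧ commonSeq f G n s ≠ [] ∧
    (∀ e ∈ (commonSeq f G n s).head?, ¬ G.IsPow e) ∧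
    (∀ e ∈ (commonSeq f G n s).getLast?, ¬ G.IsPow e) ∧
    (0 < n → ∃ c, G.Cut (shrink f G T (t + n)) c ∧ (G.valSeq A).length < c ∧
      c < (G.valSeq A).length + (G.valSeq s).length) ∧
    (∀ c, G.Cut (shrink f G T (t + n)) c → (G.valSeq A).length < c →
      c < (G.valSeq A).length + (G.valSeq s).length →
      (∃ c', (G.valSeq A).length + c' = c ∧ G.GoodCut (commonSeq f G n s) c') ∨
      (¬ G.Cut (pow f G T (t + n)) c ∧
        (0 < n → ∃ c', G.Cut (shrink f G T (t + n)) c' ∧ (G.valSeq A).length < c' ∧ c' < c))) := by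
  induction n with
  | zero =>
    intro t A s B ht hs hne _
    have hnp := hE.not_isPow_of_mem_shrink hf ht
    have hp := hE.pow_mem t ht
    refine ⟨ht, fun e he => hE.shrink_mem t ht e (by simp [hs, show e ∈ s from he]), rfl, hne,
      fun e he => hnp e ?_, fun e he => hnp e ?_, by simp, ?_⟩
    · simp [hs, List.mem_of_mem_head? (show e ∈ s.head? from he)]
    · simp [hs, List.mem_of_mem_getLast? (show e ∈ s.getLast? from he)]
    -- A cut of `Shrink_t` that `Pow_t` loses lies inside a run: this is the exceptional
    -- alternative.
    · intro c _ h1 h2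
      by_cases hc : G.Cut (pow f G T t) c
      · left
        rw [pow, hs] at hc hp
        exact GoodCut.of_cut_powOf hp hc h1 h2
      · exact Or.inr ⟨hc, by simp⟩
  | succ n IH =>
    intro t A s B ht hs hne hlong
    have hl : IsLong M s := hlong 0 (by omega)
    obtain ⟨htH, hw, ⟨A₁, B₁, hp, hA₁⟩, ⟨A₂, B₂, hx, hA₂⟩, hxv⟩ := hE.step hf ht hs hl
    have hse := (epow_eq_of_two_le hl.two_le).2
    have hL0 := hatL_ne_nil hl.two_le
    have hR0 := hatR_ne_nil hl.two_le
    have hLc := hatL_isChain s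
    have hRc := hatR_isChain s
    have hwl := hl.length_powOf_hatCore (G := G)
    have hpar : IsParsable M (powOf G (hatCore s)) := isParsable_powOf hE.vars_lt hw (by omega)
    obtain ⟨l1, l2, -⟩ := lenL_spec hf hpar hwl
    obtain ⟨r1, r2, -⟩ := lenR_spec hf hpar hwl
    have hdL : 0 < deltaL M := by unfold deltaL; omega
    have hlr : lenL f (powOf G (hatCore s)) + lenR f (powOf G (hatCore s)) ≤
      (powOf G (hatCore s)).length := by omega
    have hwe := prefL_append_innerPart_append_suffR hlr
    have hpl := length_prefL hlr
    have hsl := length_suffR hlr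
    have hil := length_innerPart (f := f) (p := powOf G (hatCore s))
    have hwv := valSeq_powOf hw
    have hchain := hpar.isChain
    have hpow := isPow_of_mem_powOf hw
    have hmem := hE.shrink_mem t ht
    have hnp := hE.not_isPow_of_mem_shrink hf ht
    have hpm := hE.pow_mem t ht
    rw [hs] at hmem hnp
    rw [commonSeq]
    generalize powOf G (hatCore s) = w at *
    generalize prefL f w = L at *
    generalize suffR f w = R at *
    generalize innerPart f w = I at *
    generalize hatL s = hl at *
    generalize hatR s = hr at *
    generalize hatCore s = core at *
    have hL1 : L ≠ [] := by rintro rfl; simp at hpl; omega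
    have hR1 : R ≠ [] := by rintro rfl; simp at hsl; omega
    have hI1 : I ≠ [] := by rintro rfl; simp at hil; omega
    subst hwe
    have hlp : 0 < (G.valSeq hl).length :=
      G.length_valSeq_pos (fun e he => hmem e (by simp [hse, he])) hL0
    have hrp : 0 < (G.valSeq hr).length :=
      G.length_valSeq_pos (fun e he => hmem e (by simp [hse, he])) hR0
    have hIp : 0 < (G.valSeq I).length :=
      G.length_valSeq_pos (fun e he => hw e (by simp [he])) hI1
    have hxne : xnext f G s ≠ [] := by intro h; rw [← hxv, h] at hIp; simp at hIp
    obtain ⟨i1, i2, i3, i4, i5, i6, i7, i8⟩ := IH (t := t + 1) htH hx hxne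
      (fun j hj => by simpa using hlong (j + 1) (by omega))
    generalize commonSeq f G n (xnext f G s) = U at *
    have e1 := congrArg List.length hA₁
    have e2 := congrArg List.length hA₂
    have e3 := congrArg List.length hxv
    have e4 := congrArg List.length hwv
    have e5 := congrArg (fun u => (G.valSeq u).length) hse
    have e6 := congrArg List.length i3
    simp only [valSeq_append, List.length_append] at e1 e2 e4 e5
    rw [show t + (n + 1) = t + 1 + n by omega]
    refine ⟨i1, ?_, ?_, by simp [hL0], ?_, ?_, fun _ => ?_, ?_⟩
    · intro e he
      simp only [List.mem_append] at he
      rcases he with (((he | he) | he) | he) | he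
      · exact hmem e (by simp [hse, he])
      · exact hw e (by simp [he])
      · exact i2 e he
      · exact hw e (by simp [he])
      · exact hmem e (by simp [hse, he])
    · conv_rhs => rw [hse]
      simp only [valSeq_append, i3, hxv, ← hwv, List.append_assoc]
    · intro e he
      simp only [List.append_assoc, List.head?_append_of_ne_nil _ hL0] at he
      exact hnp e (by simp [hse, List.mem_of_mem_head? he])
    · intro e he
      rw [List.getLast?_append_of_ne_nil _ hR0] at he
      exact hnp e (by simp [hse, List.mem_of_mem_getLast? he])
    -- For the last level the left end of `XShrink` serves as the interior cut; it lies inside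
    -- because the removed prefix is nonempty.
    · rcases Nat.eq_zero_or_pos n with rfl | hn
      · exact ⟨(G.valSeq A₂).length, ⟨A₂, xnext f G s ++ B₂, by simp [hx], rfl⟩, by omega, by omega⟩
      · obtain ⟨c, h1, h2, h3⟩ := i7 hn
        exact ⟨c, h1, by omega, by omega⟩
    · intro c hc h1 h2
      -- The cut `c` is located along `hl`, `L`, `U`, `R`, `hr`. It cannot lie inside the runs `hl`
      -- and `hr`, since it is a cut of `Pow_t`. Inside `L` and `R` neighbours differ, and inside
      -- the next level the induction hypothesis applies. At the four seams the elements differ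
      -- because exactly one of them is a run variable.
      have hcP := hE.cut_pow_of_cut_shrink hf (t := t) (by omega) i1 hc
      by_cases k1 : c < (G.valSeq A).length + (G.valSeq hl).length
      · rw [pow] at hcP hpm
        have es : shrink f G T t = A ++ hl ++ (core ++ hr ++ B) := by rw [hs, hse]; simp
        rw [es] at hcP hpm
        obtain ⟨c', -, h⟩ := GoodCut.of_cut_powOf hpm hcP h1 k1
        exact absurd h (not_goodCut_of_isChain_eq hLc c')
      by_cases k2 : c = (G.valSeq A).length + (G.valSeq hl).length
      · refine Or.inl ⟨_, k2.symm, ?_⟩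
        rw [show hl ++ L ++ U ++ R ++ hr = hl ++ (L ++ U ++ R ++ hr) by simp]
        refine goodCut_append (φ := fun e => ¬ G.IsPow e) hL0 (by simp [hL1]) ?_ ?_
        · intro e he
          exact hnp e (by simp [hse, List.mem_of_mem_getLast? he])
        · intro e he
          simp only [List.append_assoc, List.head?_append_of_ne_nil _ hL1] at he
          exact not_not.2 (hpow e (by simp [List.mem_of_mem_head? he]))
      by_cases k3 : c < (G.valSeq A₁).length + (G.valSeq L).length
      · rw [show pow f G T t = A₁ ++ L ++ (I ++ R ++ B₁) by rw [hp]; simp] at hcP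
        obtain ⟨c', h, hg⟩ := GoodCut.of_isChain_ne (hchain.infix ⟨[], I ++ R, by simp⟩) hcP
          (by omega) k3
        exact Or.inl ⟨(G.valSeq hl).length + c', by omega,
          by simpa using hg.append hl (U ++ R ++ hr)⟩
      by_cases k4 : c = (G.valSeq A₂).length
      · refine Or.inl ⟨(G.valSeq (hl ++ L)).length, by simp; omega, ?_⟩
        rw [show hl ++ L ++ U ++ R ++ hr = (hl ++ L) ++ (U ++ R ++ hr) by simp]
        refine goodCut_append (φ := fun e => G.IsPow e) (by simp [hL0]) (by simp [hR0]) ?_ ?_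
        · intro e he
          rw [List.getLast?_append_of_ne_nil _ hL1] at he
          exact hpow e (by simp [List.mem_of_mem_getLast? he])
        · intro e he
          simp only [List.append_assoc, List.head?_append_of_ne_nil _ i4] at he
          exact i5 e he
      by_cases k5 : c < (G.valSeq A₂).length + (G.valSeq (xnext f G s)).length
      · rcases i8 c hc (by omega) k5 with ⟨c', h, hg⟩ | ⟨h3, h4⟩
        · exact Or.inl ⟨(G.valSeq (hl ++ L)).length + c', by simp; omega,
            by simpa using hg.append (hl ++ L) (R ++ hr)⟩
        · refine Or.inr ⟨h3, fun _ => ?_⟩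
          -- The case that `c` is the left end of `xnext f G s` is already settled, so this left end
          -- is an earlier cut.
          rcases Nat.eq_zero_or_pos n with rfl | hn
          · exact ⟨(G.valSeq A₂).length, ⟨A₂, xnext f G s ++ B₂, by simp [hx], rfl⟩,
              by omega, by omega⟩
          · obtain ⟨c', h5, h6, h7⟩ := h4 hn
            exact ⟨c', h5, by omega, h7⟩
      left
      by_cases k6 : c = (G.valSeq A₂).length + (G.valSeq (xnext f G s)).length
      · refine ⟨(G.valSeq (hl ++ L ++ U)).length, by simp; omega, ?_⟩
        rw [show hl ++ L ++ U ++ R ++ hr = (hl ++ L ++ U) ++ (R ++ hr) by simp]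
        refine goodCut_append (φ := fun e => ¬ G.IsPow e) (by simp [hL0]) (by simp [hR0]) ?_ ?_
        · intro e he
          rw [List.getLast?_append_of_ne_nil _ i4] at he
          exact i6 e he
        · intro e he
          rw [List.head?_append_of_ne_nil _ hR1] at he
          exact not_not.2 (hpow e (by simp [List.mem_of_mem_head? he]))
      by_cases k7 : c < (G.valSeq (A₁ ++ L ++ I)).length + (G.valSeq R).length
      · rw [show pow f G T t = (A₁ ++ L ++ I) ++ R ++ B₁ by rw [hp]; simp] at hcP
        obtain ⟨c', h, hg⟩ := GoodCut.of_isChain_ne (hchain.infix ⟨L ++ I, [], by simp⟩) hcP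
          (by simp; omega) k7
        exact ⟨(G.valSeq (hl ++ L ++ U)).length + c', by simp at h ⊢; omega,
          by simpa using hg.append (hl ++ L ++ U) hr⟩
      simp only [valSeq_append, List.length_append] at k7
      by_cases k8 : c = (G.valSeq A₁).length + (G.valSeq L).length + (G.valSeq I).length +
          (G.valSeq R).length
      · refine ⟨(G.valSeq (hl ++ L ++ U ++ R)).length, by simp; omega, ?_⟩
        refine goodCut_append (φ := fun e => G.IsPow e) (by simp [hL0]) hR0 ?_ ?_
        · intro e he
          rw [List.getLast?_append_of_ne_nil _ hR1] at he
          exact hpow e (by simp [List.mem_of_mem_getLast? he])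
        · intro e he
          exact hnp e (by simp [hse, List.mem_of_mem_head? he])
      · rw [pow] at hcP hpm
        have es : shrink f G T t = (A ++ hl ++ core) ++ hr ++ B := by rw [hs, hse]; simp
        rw [es] at hcP hpm
        obtain ⟨c', -, h⟩ := GoodCut.of_cut_powOf hpm hcP (by simp; omega) (by simp; omega)
        exact absurd h (not_goodCut_of_isChain_eq hRc c')

end

/-! ### Primary occurrences -/

section

variable {α : Type*} {M : ℕ} {f : WindowFun M} {G : RLSLP α} {T : List α} {H : ℕ}

/-- Every variable is used in the derivation of `T`. -/
theorem Encodes.mem_cases (hf : IsLocallyConsistent f) (hE : Encodes f G T H) {e : ℕ}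
    (he : e ∈ G.vars) :
    (∃ a, G.rhs e = .char a) ∨ (∃ t ≤ H, e ∈ pow f G T t) ∨
    ∃ t < H, ∃ b y b', b ≠ [] ∧ e = G.sigBlock (b ++ [y]) ∧
      b ++ [y] ++ b' ∈ eblock (bits f (pow f G T t)) 0 (pow f G T t) := by
  have key := G.not_useless e he
  clear he
  suffices h : e ∈ G.vars ∧ ((∃ a, G.rhs e = .char a) ∨ (∃ t ≤ H, e ∈ pow f G T t) ∨
    ∃ t < H, ∃ b y b', b ≠ [] ∧ e = G.sigBlock (b ++ [y]) ∧
      b ++ [y] ++ b' ∈ eblock (bits f (pow f G T t)) 0 (pow f G T t)) from h.2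
  induction key with
  | refl => exact ⟨G.start_mem, Or.inr (Or.inl ⟨H, le_rfl, by simp [hE.pow_top]⟩)⟩
  | @tail x c _ hc IH =>
    obtain ⟨hx, IH⟩ := IH
    refine ⟨G.mem_of_mentions x hx c hc, ?_⟩
    rcases IH with ⟨a, hr⟩ | ⟨t, ht, hxt⟩ | ⟨t, ht, b, y, b', hb, rfl, hblk⟩
    · simp [hr, Expr.Mentions] at hc
    · obtain ⟨r, hr, rfl⟩ := List.mem_map.1 hxt
      rw [G.rhs_sigRun hx] at hc
      change c = r.headD 0 at hc
      have hcs : c ∈ shrink f G T t := by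
        obtain ⟨z, r', rfl⟩ := List.exists_cons_of_ne_nil (ne_nil_of_mem_epow hr)
        rw [← epow_flatten (shrink f G T t)]
        exact List.mem_flatten.2 ⟨_, hr, by simp [hc]⟩
      have hm := hE.shrink_mem t ht c hcs
      cases t with
      | zero =>
        obtain ⟨a, -, rfl⟩ := List.mem_map.1 hcs
        exact Or.inl ⟨a, G.rhs_sig hm⟩
      | succ t =>
        obtain ⟨b, hb, rfl⟩ := List.mem_map.1 hcs
        obtain ⟨b₀, y, hb₀, rfl⟩ :=
          exists_eq_concat_of_two_le (hE.two_le_length_of_mem hf ht b hb)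
        exact Or.inr (Or.inr ⟨t, ht, b₀, y, [], hb₀, rfl, by rw [List.append_nil]; exact hb⟩)
    · rw [G.rhs_sigBlock_concat hb hx] at hc
      have hsub : ∀ z ∈ b ++ [y] ++ b', z ∈ pow f G T t := by
        intro z hz
        rw [← eblock_flatten (bits f (pow f G T t)) 0 (pow f G T t)]
        exact List.mem_flatten.2 ⟨_, hblk, hz⟩
      rcases hc with rfl | rfl
      · by_cases hb2 : 2 ≤ b.length
        · obtain ⟨b₀, y₀, hb₀, rfl⟩ := exists_eq_concat_of_two_le hb2
          exact Or.inr (Or.inr ⟨t, ht, b₀, y₀, [y] ++ b', hb₀, rfl, by simpa using hblk⟩)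
        · obtain ⟨z, hz⟩ := List.length_eq_one_iff.1
            (show b.length = 1 by have := List.length_pos_iff.2 hb; omega)
          subst hz
          exact Or.inr (Or.inl ⟨t, ht.le, hsub _ (by simp [sigBlock_singleton])⟩)
      · exact Or.inr (Or.inl ⟨t, ht.le, hsub _ (by simp)⟩)

/-- A primary occurrence of `P` gives an occurrence of `P` in `T` whose split point is a cut of
a level that has no cuts inside this occurrence one step up. -/
theorem Encodes.exists_occurrence (hf : IsLocallyConsistent f) (hE : Encodes f G T H)
    {P : List α} {j : ℕ} {q : ℕ × ℕ} (hq : q ∈ G.pOccAt P j) :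
    1 ≤ j ∧ j < P.length ∧ ∃ A B, T = A ++ P ++ B ∧
    ((∃ t ≤ H, G.Cut (shrink f G T t) (A.length + j) ∧
      (∀ c, A.length < c → c < A.length + P.length → ¬ G.Cut (pow f G T t) c) ∧
      (∀ c, A.length < c → c < A.length + j → ¬ G.Cut (shrink f G T t) c) ∧
      (t = 0 → j = 1 ∧ ∃ a, ∀ x ∈ P, x = a)) ∨
    ∃ t < H, G.Cut (pow f G T t) (A.length + j) ∧
      ∀ c, A.length < c → c < A.length + P.length → ¬ G.Cut (shrink f G T (t + 1)) c) := by
  obtain ⟨e, i⟩ := q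
  obtain ⟨he, P₁, P₂, rfl, rfl, h1, h2, ⟨X, hX⟩, ⟨Y, hY⟩, -⟩ := hq
  refine ⟨h1, h2, ?_⟩
  change e ∈ G.vars at he
  change X ++ P₁ = G.left e at hX
  change P₂ ++ Y = G.right e at hY
  rcases hE.mem_cases hf he with ⟨a, hr⟩ | ⟨t, ht, het⟩ | ⟨t, ht, b, y, b', hb, rfl, hblk⟩
  -- The left string of `X → a` is empty and has no nonempty suffix.
  · simp only [left, hr, List.append_eq_nil_iff] at hX
    simp [hX.2] at h1
  · have hpm := hE.pow_mem t ht
    obtain ⟨C, D, hCD⟩ := List.append_of_mem het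
    obtain ⟨E₁, E₂, hE12, rfl, h3⟩ := List.map_eq_append_iff.1 hCD
    obtain ⟨r, E₃, rfl, rfl, rfl⟩ := List.map_eq_cons_iff.1 h3
    have hre : r ∈ epow (shrink f G T t) := by simp [hE12]
    have hvals := val_sigRun_of_powOf hpm
    have hvr := hvals r hre
    have hv1 : G.valSeq (E₁.map G.sigRun) = G.valSeq E₁.flatten :=
      G.valSeq_map fun b hb => hvals b (by simp [hE12, hb])
    have hrr := G.rhs_sigRun he
    have hrep := eq_replicate_of_isChain_eq (isChain_of_mem_epow hre)
    obtain ⟨x, r', rfl⟩ := List.exists_cons_of_ne_nil (ne_nil_of_mem_epow hre)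
    have hS : shrink f G T t = E₁.flatten ++ [x] ++ (r' ++ E₃.flatten) := by
      rw [← epow_flatten (shrink f G T t), hE12]; simp
    have hr' : r' = List.replicate r'.length x := by
      simpa [List.replicate_succ] using hrep
    have hl : G.left (G.sigRun (x :: r')) = G.val x := by simp [left, hrr]
    have hrt : G.right (G.sigRun (x :: r')) = G.valSeq r' := by
      rw [hr', valSeq_replicate, ← hr']; simp [right, hrr]
    rw [hl] at hX
    rw [hrt] at hY
    have lX := congrArg List.length hX
    have lY := congrArg List.length hY
    have lv := congrArg List.length hvr
    simp only [List.length_append, valSeq_cons] at lX lY lv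
    refine ⟨G.valSeq E₁.flatten ++ X, Y ++ G.valSeq E₃.flatten, ?_, Or.inl ⟨t, ht, ?_, ?_, ?_, ?_⟩⟩
    · rw [← hE.valSeq_shrink hf ht, hS]
      simp [← hX, ← hY]
    · refine ⟨E₁.flatten ++ [x], r' ++ E₃.flatten, hS, ?_⟩
      simp only [valSeq_append, valSeq_cons, valSeq_nil, List.append_nil, List.length_append]
      omega
    -- The occurrence lies within the text of one element of `Pow_t`.
    · intro c hc1 hc2
      simp only [List.length_append] at hc1 hc2
      have := not_cut_of_lt (G := G) (X := E₁.map G.sigRun) (Z := E₃.map G.sigRun)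
        (e := G.sigRun (x :: r')) (c := c) (by rw [hv1]; omega) (by rw [hv1]; omega)
      rwa [List.append_assoc, List.singleton_append, ← hCD] at this
    -- `P₁` lies within the first copy `x` of the run, so the split is the leftmost cut.
    · intro c hc1 hc2
      simp only [List.length_append] at hc1 hc2
      rw [hS]
      exact not_cut_of_lt (by omega) (by omega)
    · rintro rfl
      -- At level `0` a copy is one character, which forces `|P₁| = 1` and makes `P` constant.
      have hx : x ∈ shrink f G T 0 := by simp [hS]
      have hxm := hE.shrink_mem 0 ht x hx
      obtain ⟨a, -, rfl⟩ := List.mem_map.1 hx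
      have hva := G.val_char hxm (G.rhs_sig hxm)
      rw [hva, List.length_singleton] at lX
      refine ⟨by omega, a, ?_⟩
      intro z hz
      rcases List.mem_append.1 hz with hz | hz
      · have : z ∈ X ++ P₁ := by simp [hz]
        rw [hX, hva] at this
        simpa using this
      · have : z ∈ P₂ ++ Y := by simp [hz]
        rw [hY, hr', valSeq_replicate, hva] at this
        simp at this
        exact this.2
  · have hr := G.rhs_sigBlock_concat hb he
    -- The split is the border between `b` and `y` in `Pow_t`, and the occurrence lies within a
    -- single block.
    have hbm : G.sigBlock b ∈ G.vars :=
      G.mem_of_mentions _ he _ (by rw [hr]; simp [Expr.Mentions])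
    have hbv := (G.mem_and_val_of_sigBlock_mem hb hbm).2
    have hl : G.left (G.sigBlock (b ++ [y])) = G.valSeq b := by simp [left, hr, hbv]
    have hrt : G.right (G.sigBlock (b ++ [y])) = G.val y := by simp [right, hr]
    rw [hl] at hX
    rw [hrt] at hY
    have hvals := hE.val_sigBlock hf ht
    have hvb := hvals _ hblk
    obtain ⟨E₁, E₂, hE12⟩ := List.append_of_mem hblk
    have hv1 : G.valSeq (E₁.map G.sigBlock) = G.valSeq E₁.flatten :=
      G.valSeq_map fun b hb => hvals b (by rw [hE12]; exact List.mem_append_left _ hb)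
    have hS : pow f G T t = E₁.flatten ++ b ++ ([y] ++ b' ++ E₂.flatten) := by
      conv_lhs => rw [← eblock_flatten (bits f (pow f G T t)) 0 (pow f G T t), hE12]
      simp
    have hS' : shrink f G T (t + 1) =
        E₁.map G.sigBlock ++ [G.sigBlock (b ++ [y] ++ b')] ++ E₂.map G.sigBlock := by
      rw [shrink, ← pow, hE12]; simp
    have lX := congrArg List.length hX
    have lY := congrArg List.length hY
    have lv := congrArg List.length hvb
    simp only [List.length_append, valSeq_append, valSeq_cons, valSeq_nil, List.append_nil]
      at lX lY lv
    refine ⟨G.valSeq E₁.flatten ++ X, Y ++ G.valSeq (b' ++ E₂.flatten), ?_,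
      Or.inr ⟨t, ht, ?_, ?_⟩⟩
    · rw [← hE.valSeq_shrink hf ht.le, ← valSeq_powOf (hE.pow_mem t ht.le), ← pow, hS]
      simp [← hX, ← hY]
    · refine ⟨E₁.flatten ++ b, _, hS, ?_⟩
      simp only [valSeq_append, List.length_append]
      omega
    · intro c hc1 hc2
      simp only [List.length_append] at hc1 hc2
      rw [hS']
      exact not_cut_of_lt (by rw [hv1]; omega) (by rw [hv1]; omega)

theorem mem_splitPoints_of_goodCut {u : List ℕ} {c : ℕ} (h : G.GoodCut u c) :
    c ∈ splitPoints G u := by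
  obtain ⟨p, q, rfl, hp, hq, hne, rfl⟩ := h
  obtain ⟨p, x, rfl⟩ := (List.eq_nil_or_concat p).resolve_left hp
  obtain ⟨y, q, rfl⟩ := List.exists_cons_of_ne_nil hq
  simp only [List.concat_eq_append, List.getLast?_append, List.getLast?_singleton,
    Option.some_or, List.head?_cons, ne_eq, Option.some.injEq] at hne
  refine Finset.mem_image.2 ⟨p.length, Finset.mem_filter.2 ⟨?_, ?_⟩, ?_⟩
  · simp
  · simpa [List.getD_append_right] using hne
  · rw [List.take_left' (by simp)]

/-- The sequence of characters of a substring of `T` in the lowest level. -/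
theorem Encodes.shrink_zero_eq (hE : Encodes f G T H) {A P B : List α} (hT : T = A ++ P ++ B) :
    shrink f G T 0 = (A.map fun a => G.sig (.char a)) ++ (P.map fun a => G.sig (.char a)) ++
      (B.map fun a => G.sig (.char a)) ∧
    G.valSeq (A.map fun a => G.sig (.char a)) = A ∧
    G.valSeq (P.map fun a => G.sig (.char a)) = P := by
  have h : ∀ a ∈ T, G.sig (.char a) ∈ G.vars := fun a ha =>
    hE.shrink_mem 0 (Nat.zero_le _) _ (List.mem_map_of_mem ha)
  refine ⟨by simp [shrink, hT], G.valSeq_map_sig_char fun a ha => h a (by simp [hT, ha]),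
    G.valSeq_map_sig_char fun a ha => h a (by simp [hT, ha])⟩

theorem length_pow_zero_of_const {P : List α} (hP : P ≠ []) {a : α} (h : ∀ x ∈ P, x = a) :
    (pow f G P 0).length = 1 := by
  have : P = List.replicate P.length a := List.eq_replicate_iff.2 ⟨rfl, h⟩
  rw [pow, length_powOf, shrink, this, List.map_replicate,
    epow_of_isChain_eq (by simpa using hP) (isChain_eq_replicate _ _)]
  rfl

theorem mem_Ico_of_mem_pOccAt {P : List α} {j : ℕ} {q : ℕ × ℕ} (hq : q ∈ G.pOccAt P j) :
    j ∈ Set.Ico 1 P.length := by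
  obtain ⟨-, P₁, P₂, -, rfl, h1, h2, -⟩ := hq
  exact ⟨h1, h2⟩

/-- Inside a run of `Shrink_0` there is no cut of `Pow_0`, nor of any higher level. Hence the split
comes from a run variable of level `0`, whose left string is one character. `P` need not be assumed
to occur in `T`: a primary occurrence supplies an occurrence. -/
theorem Encodes.pOcc_eq_of_run (hf : IsLocallyConsistent f) (hE : Encodes f G T H) {P : List α}
    (hP : (pow f G P 0).length = 1) : G.pOcc P = G.pOccAt P 1 := by
  apply Set.Subset.antisymm
  · intro q hq
    simp only [pOcc, Set.mem_iUnion] at hq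
    obtain ⟨j, -, hq⟩ := hq
    obtain ⟨h1, h2, A, B, hT, h⟩ := hE.exists_occurrence hf hq
    suffices j = 1 by rwa [← this]
    obtain ⟨hS, hvA, hvP⟩ := hE.shrink_zero_eq hT
    have hcut : ¬ G.Cut (pow f G T 0) (A.length + j) := by
      intro hc
      have hpm := hE.pow_mem 0 (Nat.zero_le _)
      rw [pow, hS] at hc hpm
      obtain ⟨c', -, hg⟩ := GoodCut.of_cut_powOf hpm hc (by rw [hvA]; omega)
        (by rw [hvA, hvP]; omega)
      refine not_goodCut_of_isChain_eq ?_ c' hg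
      rw [pow, length_powOf, List.length_eq_one_iff] at hP
      obtain ⟨r, hr⟩ := hP
      change epow (P.map fun a => G.sig (.char a)) = [r] at hr
      have := isChain_of_mem_epow (s := P.map fun a => G.sig (.char a)) (b := r) (by simp [hr])
      rwa [← epow_flatten (P.map _), hr, List.flatten_singleton]
    rcases h with ⟨t, ht, hc, -, -, h0⟩ | ⟨t, ht, hc, -⟩
    · rcases Nat.eq_zero_or_pos t with rfl | hpos
      · exact (h0 rfl).1
      · exact absurd (hE.cut_pow_of_cut_shrink hf hpos ht hc) hcut
    · rcases Nat.eq_zero_or_pos t with rfl | hpos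
      · exact absurd hc hcut
      · exact absurd (hE.cut_pow_of_cut_shrink hf hpos ht.le (hE.cut_shrink_of_cut_pow ht.le hc))
          hcut
  · intro q hq
    simp only [pOcc, Set.mem_iUnion]
    exact ⟨1, mem_Ico_of_mem_pOccAt hq, hq⟩

theorem Encodes.goodCut_uniq (hf : IsLocallyConsistent f) (hE : Encodes f G T H) {P : List α}
    (hP : 1 < (pow f G P 0).length) {j : ℕ} {q : ℕ × ℕ} (hq : q ∈ G.pOccAt P j) :
    G.GoodCut (uniq f G P) j := by
  obtain ⟨h1, h2, A, B, hT, h⟩ := hE.exists_occurrence hf hq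
  obtain ⟨hS, hvA, hvP⟩ := hE.shrink_zero_eq hT
  have hne : P ≠ [] := by rintro rfl; simp at h2
  obtain ⟨s1, -, -, -, -, -, s7, s8⟩ := hE.commonSeq_spec hf (SigEnc.hP f G P) (Nat.zero_le _) hS
    (by simpa using hne) (fun j hj => isLong_of_lt_hP hj)
  rw [← uniq_eq_commonSeq, hvA, hvP] at s8
  rw [hvA, hvP] at s7
  simp only [zero_add] at s1 s7 s8
  generalize SigEnc.hP f G P = n at *
  -- Either condition on the split excludes the exceptional alternative of `Encodes.commonSeq_spec`.
  have fin : G.Cut (shrink f G T n) (A.length + j) →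
      (G.Cut (pow f G T n) (A.length + j) ∨
        (0 < n ∧ ∀ c, A.length < c → c < A.length + j → ¬ G.Cut (shrink f G T n) c)) →
      G.GoodCut (uniq f G P) j := by
    intro hc hc'
    rcases s8 _ hc (by omega) (by omega) with ⟨c', h3, h4⟩ | ⟨h3, h4⟩
    · rwa [show j = c' by omega]
    · rcases hc' with hc' | ⟨h5, h6⟩
      · exact absurd hc' h3
      · obtain ⟨c', h7, h8, h9⟩ := h4 h5
        exact absurd h7 (h6 c' h8 h9)
  rcases h with ⟨t, ht, hc, hp, hs, h0⟩ | ⟨t, ht, hc, hs⟩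
  · rcases lt_trichotomy t n with htn | rfl | htn
    · obtain ⟨c, h3, h4, h5⟩ := s7 (by omega)
      exact absurd (hE.cut_pow_of_cut_shrink hf htn s1 h3) (hp c h4 h5)
    · rcases Nat.eq_zero_or_pos t with rfl | hpos
      · obtain ⟨-, a, ha⟩ := h0 rfl
        have := length_pow_zero_of_const (f := f) (G := G) hne ha
        omega
      · exact fin hc (Or.inr ⟨hpos, hs⟩)
    · exact fin (hE.cut_shrink_mono hf htn.le ht hc)
        (Or.inl (hE.cut_pow_of_cut_shrink hf htn ht hc))
  · have hc' := hE.cut_shrink_of_cut_pow ht.le hc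
    rcases lt_trichotomy t n with htn | rfl | htn
    · obtain ⟨c, h3, h4, h5⟩ := s7 (by omega)
      exact absurd (hE.cut_shrink_mono hf htn s1 h3) (hs c h4 h5)
    · exact fin hc' (Or.inl hc)
    · exact fin (hE.cut_shrink_mono hf htn.le ht.le hc')
        (Or.inl (hE.cut_pow_of_cut_shrink hf htn ht.le hc'))

theorem Encodes.pOcc_eq (hf : IsLocallyConsistent f) (hE : Encodes f G T H) {P : List α}
    (hP : 1 < (pow f G P 0).length) :
    G.pOcc P = ⋃ j ∈ splitPoints G (uniq f G P), G.pOccAt P j := by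
  ext q
  simp only [pOcc, Set.mem_iUnion]
  constructor
  · rintro ⟨j, -, hq⟩
    exact ⟨j, mem_splitPoints_of_goodCut (hE.goodCut_uniq hf hP hq), hq⟩
  · rintro ⟨j, -, hq⟩
    exact ⟨j, mem_Ico_of_mem_pOccAt hq, hq⟩

theorem Encodes.uniq_mem (hf : IsLocallyConsistent f) (hE : Encodes f G T H) {P : List α}
    (hne : P ≠ []) (hP : P <:+: T) : ∀ e ∈ uniq f G P, e ∈ G.vars := by
  obtain ⟨A, B, hT⟩ := hP
  rw [uniq_eq_commonSeq]
  exact (hE.commonSeq_spec hf (SigEnc.hP f G P) (Nat.zero_le _) (hE.shrink_zero_eq hT.symm).1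
    (by simpa using hne) (fun j hj => isLong_of_lt_hP hj)).2.1

end

/-! ### The number of split points -/

section

variable {α : Type*} {M : ℕ} {f : WindowFun M} {G : RLSLP α}

/-- The sequence `u` is a concatenation of at most `N` runs. -/
def HasRuns (u : List ℕ) (N : ℕ) : Prop :=
  ∃ E : List (List ℕ), E.flatten = u ∧ (∀ b ∈ E, b.IsChain (· = ·)) ∧ E.length ≤ N

theorem HasRuns.append {u v : List ℕ} {N K : ℕ} (hu : HasRuns u N) (hv : HasRuns v K) :
    HasRuns (u ++ v) (N + K) := by
  obtain ⟨E, rfl, h1, h2⟩ := hu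
  obtain ⟨F, rfl, h3, h4⟩ := hv
  refine ⟨E ++ F, by simp, ?_, by simp; omega⟩
  intro b hb
  exact (List.mem_append.1 hb).elim (h1 b) (h3 b)

theorem HasRuns.mono {u : List ℕ} {N K : ℕ} (h : HasRuns u N) (hNK : N ≤ K) : HasRuns u K := by
  obtain ⟨E, rfl, h1, h2⟩ := h
  exact ⟨E, rfl, h1, h2.trans hNK⟩

theorem hasRuns_one {u : List ℕ} (h : u.IsChain (· = ·)) : HasRuns u 1 :=
  ⟨[u], by simp, by simpa using h, le_rfl⟩

theorem hasRuns_length (u : List ℕ) : HasRuns u u.length := by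
  refine ⟨u.map fun x => [x], ?_, ?_, by simp⟩
  · induction u with
    | nil => rfl
    | cons x u IH => simpa using IH
  · intro b hb
    obtain ⟨x, -, rfl⟩ := List.mem_map.1 hb
    simp

theorem hasRuns_epow (u : List ℕ) : HasRuns u (epow u).length :=
  ⟨epow u, epow_flatten u, fun _ hb => isChain_of_mem_epow hb, le_rfl⟩

theorem HasRuns.card_filter_le {u : List ℕ} {N : ℕ} (h : HasRuns u N) :
    ((Finset.range (u.length - 1)).filter fun i => u.getD i 0 ≠ u.getD (i + 1) 0).card ≤ N := by
  obtain ⟨E, rfl, h1, h2⟩ := h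
  refine le_trans ?_ h2
  clear h2
  induction E with
  | nil => simp
  | cons b E IH =>
    have IH := IH fun c hc => h1 c (by simp [hc])
    rw [List.flatten_cons]
    generalize E.flatten = u at *
    -- Inside `b` nothing changes, so the only new position is the end of `b`. For empty `b` the
    -- inserted `0` merely weakens the bound.
    refine le_trans (Finset.card_le_card (t := insert (b.length - 1)
      (((Finset.range (u.length - 1)).filter fun i => u.getD i 0 ≠ u.getD (i + 1) 0).image
        fun i => b.length + i)) ?_) ?_
    · intro i hi
      simp only [Finset.mem_filter, Finset.mem_range, List.length_append] at hi
      obtain ⟨hi1, hi2⟩ := hi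
      rw [Finset.mem_insert, Finset.mem_image]
      rcases lt_trichotomy (i + 1) b.length with hlt | heq | hgt
      · refine absurd ?_ hi2
        rw [List.getD_append _ _ _ _ (by omega), List.getD_append _ _ _ _ hlt,
          List.getD_eq_getElem _ _ (by omega), List.getD_eq_getElem _ _ hlt]
        exact List.isChain_iff_getElem.1 (h1 b (by simp)) i hlt
      · exact Or.inl (by omega)
      · refine Or.inr ⟨i - b.length, ?_, by omega⟩
        rw [List.getD_append_right _ _ _ _ (by omega),
          List.getD_append_right _ _ _ _ (by omega)] at hi2
        simp only [Finset.mem_filter, Finset.mem_range]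
        exact ⟨by omega, by rwa [show i - b.length + 1 = i + 1 - b.length by omega]⟩
    · refine (Finset.card_insert_le _ _).trans ?_
      rw [List.length_cons]
      exact Nat.succ_le_succ (Finset.card_image_le.trans IH)

/-! ### Lengths of the levels of the common sequence -/

theorem length_epow_le (s : List ℕ) : (epow s).length ≤ s.length := by
  have := mul_length_le_length_flatten (k := 1) (E := epow s)
    fun b hb => List.length_pos_iff.2 (ne_nil_of_mem_epow hb)
  rwa [one_mul, epow_flatten] at this

theorem length_hatCore (s : List ℕ) :
    (hatCore s).length ≤ s.length - (hatL s).length := by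
  rw [hatCore, List.length_take, List.length_drop]; omega

theorem length_hatL_pos {s : List ℕ} (hs : s ≠ []) : 0 < (hatL s).length := by
  have h : epow s ≠ [] := by simpa [epow] using hs
  obtain ⟨b, E, hb⟩ := List.exists_cons_of_ne_nil h
  simpa [hatL, hb] using List.length_pos_iff.2 (ne_nil_of_mem_epow (s := s) (b := b) (by simp [hb]))

theorem length_innerPart_powOf_le (s : List ℕ) :
    (innerPart f (powOf G (hatCore s))).length ≤ s.length - (hatL s).length := by
  have h1 := length_hatCore s
  have h2 := length_epow_le (hatCore s)
  rw [length_innerPart, length_powOf]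
  omega

theorem length_xnext_le (s : List ℕ) : (xnext f G s).length ≤ s.length - (hatL s).length := by
  refine le_trans ?_ (length_innerPart_powOf_le (f := f) (G := G) s)
  have := mul_length_le_length_flatten (k := 1) (E := innerBlocks f (powOf G (hatCore s)))
    fun b hb => List.length_pos_iff.2 (ne_nil_of_mem_eblock hb)
  rwa [one_mul, innerBlocks_flatten, ← List.length_map (f := G.sigBlock)] at this

/-- Each level loses at least the first run, whatever `f` is. Hence some level is short, and the
infimum defining `hP` is attained. -/
theorem length_xshrink_le (P : List α) (t : ℕ) : (xshrink f G P t).length ≤ P.length - t := by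
  induction t with
  | zero => simp [xshrink]
  | succ t IH =>
    have h : (xshrink f G P (t + 1)).length ≤ _ := length_xnext_le (f := f) (G := G) (xshrink f G P t)
    by_cases h0 : xshrink f G P t = []
    · simp [h0] at h; simp [h]
    · have := length_hatL_pos h0
      omega

theorem length_epow_xshrink_hP_le (P : List α) :
    (epow (xshrink f G P (hP f G P))).length ≤ deltaL M + deltaR + 9 := by
  refine Nat.sInf_mem (s := {h | (epow (xshrink f G P h)).length ≤ deltaL M + deltaR + 9})
    ⟨P.length, ?_⟩
  have h1 := length_xshrink_le (f := f) (G := G) P P.length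
  have h2 := length_epow_le (xshrink f G P P.length)
  change (epow (xshrink f G P P.length)).length ≤ deltaL M + deltaR + 9
  omega

/-- Valid even if the prefix and the suffix overlap, so it is available before `lenL` and `lenR`
have been bounded. -/
theorem mem_prefL_or_innerPart_or_suffR {p : List ℕ} {e : ℕ} (he : e ∈ p) :
    e ∈ prefL f p ∨ e ∈ innerPart f p ∨ e ∈ suffR f p := by
  rw [← List.take_append_drop (lenL f p) p, List.mem_append] at he
  refine he.imp_right fun he => ?_
  rw [← List.take_append_drop (p.length - lenL f p - lenR f p) (p.drop (lenL f p)),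
    List.mem_append] at he
  refine he.imp_right fun he => ?_
  rw [List.drop_drop] at he
  exact (List.drop_sublist_drop_left p (by omega)).subset he

/-- If a common sequence is defined then so are the sequences of all its levels; their lengths are
at least halved from level to level. -/
theorem commonSeq_bounds (hf : IsLocallyConsistent f) (hG : ∀ e ∈ G.vars, e < M) (n : ℕ) :
    ∀ {s : List ℕ}, (∀ j < n, IsLong M ((xnext f G)^[j] s)) →
    (∀ e ∈ commonSeq f G n s, e ∈ G.vars) →
    (∀ e ∈ s, e ∈ G.vars) ∧ (s ≠ [] → 2 ^ n ≤ s.length) ∧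
    HasRuns (commonSeq f G n s) (n * (deltaL M + 13) + (epow ((xnext f G)^[n] s)).length) := by
  induction n with
  | zero =>
    intro s _ hmem
    refine ⟨hmem, fun hs => ?_, ?_⟩
    · exact List.length_pos_iff.2 hs
    · simpa [commonSeq] using hasRuns_epow s
  | succ n IH =>
    intro s hlong hmem
    have hl : IsLong M s := hlong 0 (by omega)
    rw [commonSeq] at hmem ⊢
    simp only [List.mem_append] at hmem
    have hwl := hl.length_powOf_hatCore (G := G)
    have hxlong : ∀ j < n, IsLong M ((xnext f G)^[j] (xnext f G s)) :=
      fun j hj => by simpa using hlong (j + 1) (by omega)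
    have hxmem : ∀ e ∈ commonSeq f G n (xnext f G s), e ∈ G.vars :=
      fun e he => hmem e (by simp [he])
    obtain ⟨i1, i2, i3⟩ := IH hxlong hxmem
    -- Definedness descends from the next level: its block signatures are defined, hence so are the
    -- elements of the blocks. Only then does the parsing property apply.
    have hw : ∀ e ∈ powOf G (hatCore s), e ∈ G.vars := by
      intro e he
      rcases mem_prefL_or_innerPart_or_suffR (f := f) he with he | he | he
      · exact hmem e (by simp [he])
      · rw [← innerBlocks_flatten] at he
        obtain ⟨b, hb, he⟩ := List.mem_flatten.1 he
        exact (G.mem_and_val_of_sigBlock_mem (ne_nil_of_mem_eblock hb)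
          (i1 _ (List.mem_map_of_mem hb))).1 e he
      · exact hmem e (by simp [he])
    have hpar : IsParsable M (powOf G (hatCore s)) := isParsable_powOf hG hw (by omega)
    obtain ⟨l1, l2, -⟩ := lenL_spec hf hpar hwl
    obtain ⟨r1, r2, -⟩ := lenR_spec hf hpar hwl
    have hlr : lenL f (powOf G (hatCore s)) + lenR f (powOf G (hatCore s)) ≤
      (powOf G (hatCore s)).length := by omega
    have hil := length_innerPart (f := f) (p := powOf G (hatCore s))
    have hhalf : 2 * (xnext f G s).length ≤ (innerPart f (powOf G (hatCore s))).length := by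
      rw [xnext, List.length_map, ← innerBlocks_flatten]
      exact mul_length_le_length_flatten (two_le_length_of_mem_innerBlocks hf hpar hwl)
    have hle := length_innerPart_powOf_le (f := f) (G := G) s
    have hx : xnext f G s ≠ [] := by
      intro h
      rw [xnext, List.map_eq_nil_iff] at h
      have h' := innerBlocks_flatten (f := f) (powOf G (hatCore s))
      rw [h, List.flatten_nil] at h'
      rw [← h', List.length_nil] at hil
      unfold deltaR at *
      omega
    refine ⟨?_, fun _ => ?_, ?_⟩
    · intro e he
      rw [(epow_eq_of_two_le hl.two_le).2] at he
      simp only [List.mem_append] at he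
      rcases he with (he | he) | he
      · exact hmem e (by simp [he])
      · exact mem_of_powOf hw e he
      · exact hmem e (by simp [he])
    · have := i2 hx
      rw [pow_succ]
      omega
    · have h1 := (hasRuns_one (hatL_isChain s)).append
        (hasRuns_length (prefL f (powOf G (hatCore s))))
      have h2 := ((h1.append i3).append (hasRuns_length (suffR f (powOf G (hatCore s))))).append
        (hasRuns_one (hatR_isChain s))
      rw [length_prefL hlr, length_suffR hlr] at h2
      rw [Function.iterate_succ_apply]
      -- One level contributes at most `1 + (Δ_L + 3) + (Δ_R + 4) + 1 = Δ_L + 13` runs.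
      refine h2.mono ?_
      have hd : deltaR = 4 := rfl
      rw [add_mul, one_mul]
      omega

/-! ### The iterated logarithm -/

theorem exists_iterate_logb_le_one (n : ℕ) :
    ∀ x : ℝ, x ≤ n + 2 → ∃ k, (Real.logb 2)^[k] x ≤ 1 := by
  have base : ∀ x : ℝ, x ≤ 2 → ∃ k, (Real.logb 2)^[k] x ≤ 1 := by
    intro x hx
    by_cases h1 : x ≤ 1
    · exact ⟨0, h1⟩
    · refine ⟨1, ?_⟩
      rw [Function.iterate_one, Real.logb_le_iff_le_rpow one_lt_two (by linarith)]
      simpa using hx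
  induction n with
  | zero => intro x hx; exact base x (by simpa using hx)
  | succ n IH =>
    intro x hx
    by_cases h2 : x ≤ 2
    · exact base x h2
    · push Not at h2
      -- Bernoulli's inequality gives `x ≤ 2^(x-1)`, so each logarithm lowers the argument by at
      -- least one while it exceeds `2`.
      have h3 : Real.logb 2 x ≤ x - 1 := by
        rw [Real.logb_le_iff_le_rpow one_lt_two (by linarith)]
        have := one_add_mul_self_le_rpow_one_add (s := 1) (by norm_num) (p := x - 1) (by linarith)
        norm_num at this
        exact this
      push_cast at hx
      obtain ⟨k, hk⟩ := IH (Real.logb 2 x) (by linarith)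
      exact ⟨k + 1, hk⟩

theorem one_le_logStar {n : ℕ} (hn : 2 ≤ n) : 1 ≤ logStar n := by
  have hne : {k : ℕ | (Real.logb 2)^[k] (n : ℝ) ≤ 1}.Nonempty :=
    exists_iterate_logb_le_one n n (by linarith)
  have hm : (Real.logb 2)^[logStar n] (n : ℝ) ≤ 1 := Nat.sInf_mem hne
  by_contra h
  rw [show logStar n = 0 by omega] at hm
  have hn' : (2 : ℝ) ≤ n := by exact_mod_cast hn
  simp only [Function.iterate_zero, id_eq] at hm
  linarith

theorem card_splitPoints_uniq_le (hf : IsLocallyConsistent f) (hG : ∀ e ∈ G.vars, e < M)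
    (hM : 2 ≤ M) {P : List α} (hP : 1 < P.length) (h : ∀ e ∈ uniq f G P, e ∈ G.vars) :
    ((splitPoints G (uniq f G P)).card : ℝ) ≤ 40 * Real.logb 2 P.length * logStar M := by
  have hne : (P.map fun a => G.sig (.char a)) ≠ [] := by
    rw [ne_eq, List.map_eq_nil_iff]; rintro rfl; simp at hP
  have hu := h
  rw [uniq_eq_commonSeq] at hu
  obtain ⟨-, h2, h3⟩ := commonSeq_bounds hf hG (SigEnc.hP f G P)
    (fun j hj => isLong_of_lt_hP hj) hu
  rw [← uniq_eq_commonSeq, ← xshrink_eq_iterate] at h3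
  replace h2 := h2 hne
  rw [List.length_map] at h2
  have h4 : (splitPoints G (uniq f G P)).card ≤ _ := Finset.card_image_le.trans h3.card_filter_le
  have h5 := length_epow_xshrink_hP_le (f := f) (G := G) P
  generalize SigEnc.hP f G P = n at *
  have h6 : (splitPoints G (uniq f G P)).card ≤ (n + 1) * (logStar M + 19) := by
    unfold deltaL deltaR at *
    calc _ ≤ _ := h4
      _ ≤ n * (logStar M + 6 + 13) + (logStar M + 6 + 4 + 9) := by omega
      _ = _ := by ring
  have h7 : (n : ℝ) ≤ Real.logb 2 P.length := by
    rw [Real.le_logb_iff_rpow_le one_lt_two (by positivity)]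
    exact_mod_cast h2
  have h8 : (1 : ℝ) ≤ Real.logb 2 P.length := by
    rw [Real.le_logb_iff_rpow_le one_lt_two (by positivity), Real.rpow_one]
    exact_mod_cast hP
  have h9 : (1 : ℝ) ≤ logStar M := by exact_mod_cast one_le_logStar hM
  -- The constant is `40 = 2 · 20`: since `log₂|P|` and `log* M` are at least `1`, they absorb the
  -- summands `1` and `19`.
  calc ((splitPoints G (uniq f G P)).card : ℝ) ≤ ((n + 1) * (logStar M + 19) : ℕ) := by
        exact_mod_cast h6
    _ = (n + 1) * (logStar M + 19) := by push_cast; ring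
    _ ≤ (2 * Real.logb 2 P.length) * (20 * logStar M) := by
        apply mul_le_mul <;> first | positivity | linarith
    _ = _ := by ring

end

end SigEnc

/-! ### The main theorem -/

theorem mainTheorem3 :
    ∃ C : ℝ, 0 < C ∧
      ∀ (α : Type*) (M : ℕ) (f : SigEnc.WindowFun M), SigEnc.IsLocallyConsistent f →
      ∀ (T : List α) (G : SigEnc.RLSLP α), SigEnc.IsSignatureEncoding f G T →
      ∀ P : List α, 1 < P.length →
        ((SigEnc.pow f G P 0).length = 1 → G.pOcc P = G.pOccAt P 1) ∧
        (1 < (SigEnc.pow f G P 0).length →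
          G.pOcc P = ⋃ j ∈ SigEnc.splitPoints G (SigEnc.uniq f G P), G.pOccAt P j) ∧
        (P <:+: T → ∀ e ∈ SigEnc.uniq f G P, e ∈ G.vars) ∧
        ((∀ e ∈ SigEnc.uniq f G P, e ∈ G.vars) →
          ((SigEnc.splitPoints G (SigEnc.uniq f G P)).card : ℝ) ≤
            C * Real.logb 2 P.length * SigEnc.logStar M) := by
  refine ⟨40, by norm_num, fun α M f hf T G hG P hP => ?_⟩
  obtain ⟨H, hE⟩ := hG.exists_encodes
  have hM : 2 ≤ M := by
    have h1 := List.length_pos_iff.2 hG.1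
    have h2 := hG.2.1
    omega
  refine ⟨hE.pOcc_eq_of_run hf, hE.pOcc_eq hf, hE.uniq_mem hf ?_,
    SigEnc.card_splitPoints_uniq_le hf hE.vars_lt hM hP⟩
  rintro rfl
  simp at hP
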